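/- All graphs are finite. An $r$-partite graph is a graph with a fixed partition of its vertex set into $r$ parts $V_1,\dots,V_r$, each of which is an independent set. A $t$-IT in such a graph is an independent set of $t$ vertices containing at most one vertex from each part. For integers $r\ge D\ge 1$ and $\Delta\ge 0$, let $n(r,D,\Delta)$ be the largest integer $n\ge 0$ such that there is an $r$-partite graph with at least $n$ vertices in each part, maximum degree $\Delta$, and no $(r-D+1)$-IT (the graph with no vertices has maximum degree $0$). For integers $n\ge 1$ and $2\le t\le r$, let $f(n,r,t)$ be the largest minimum degree among all $r$-partite graphs with exactly $n$ vertices in each part and without a copy of $K_t$. Corollary 1.2. Let $r,d,q,k$ be integers with $0\le d<r$, $r=q(d+1)+k$ and $0\le k\le d$. If $q$ is even and $q\ge 4k$, then both extremal numbers below exist and $$n(r,d+1,\Delta)=\left\lfloor 2\Delta\left(1-\frac1q\right)\right\rfloor\quad\text{for every integer }\Delta\ge 0,$$ and, equivalently, $$f(n,r,r-d)=(r-1)n-\left\lceil\frac{qn}{2(q-1)}\right\rceil\quad\text{for every integer }n\ge 1.$$ (The hypotheses imply $q\ge 2$ and $r-d\ge 2$.) -/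

import Mathlib

/-- `HasPartialIT G C t`: with respect to the parts given by the proper colouring `C`, the
multipartite graph `G` has a `t`-IT, i.e. an independent set of exactly `t` vertices which meets
each part in at most one vertex. -/
def HasPartialIT {V : Type*} {r : ℕ} (G : SimpleGraph V) (C : G.Coloring (Fin r)) (t : ℕ) : Prop :=
  ∃ S : Finset V, G.IsIndepSet (S : Set V) ∧ Set.InjOn C (S : Set V) ∧ S.card = t

/-- The set of all `n` such that some finite `r`-partite graph has at least `n` vertices in each
part, maximum degree `Δ`, and no `(r - D + 1)`-IT. The extremal number `n(r, D, Δ)` is the largest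
element of this set. An `r`-partite graph is a graph with a proper colouring by `Fin r`; its parts
are the colour classes. (It is used for `D ≤ r`, where `r + 1 - D` is not truncated.) -/
def partSizesWithoutIT (r D Δ : ℕ) : Set ℕ :=
  {n | ∃ (V : Type) (_ : Fintype V) (G : SimpleGraph V) (_ : DecidableRel G.Adj)
      (C : G.Coloring (Fin r)),
      (∀ i, n ≤ (C.colorClass i).ncard) ∧ G.maxDegree = Δ ∧ ¬ HasPartialIT G C (r + 1 - D)}

/-- The set of all minimum degrees of finite `r`-partite graphs with exactly `n` vertices in each
part and without a copy of the complete graph `K_t`. The extremal number `f(n, r, t)` is the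
largest element of this set. -/
def minDegreesCliqueFree (n r t : ℕ) : Set ℕ :=
  {m | ∃ (V : Type) (_ : Fintype V) (G : SimpleGraph V) (_ : DecidableRel G.Adj)
      (C : G.Coloring (Fin r)),
      (∀ i, (C.colorClass i).ncard = n) ∧ G.CliqueFree t ∧ G.minDegree = m}

/-! Both formulas reduce to one statement: for `n` vertices per part and maximum degree at most `Δ`,
an `(r - d)`-IT can be avoided exactly when `n * q ≤ 2 * Δ * (q - 1)`.

Necessity (`part_size_le`) refines Haxell's domination argument. Put `m = d + 1` and suppose that
every rainbow independent set misses at least `m` colours. Starting from `m` missed colours, stars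
are absorbed one at a time (`Blocked.step`), and the resulting colour set `S` is dominated by at
most `2 * (|S| - m)` vertices. The size condition forbids saving even one vertex, so all stars are
single edges. The dominating set is then an induced matching which, after contracting the colour
classes, is a forest with `m` trees on `S` (`IsDominatingForest`). As `r < (q + 1) * m`, some tree
has a colour set `C` with at most `q` colours. If its `2 * (|C| - 1)` matching vertices dominate all
classes in `C`, those classes have at most `2 * Δ * (|C| - 1)` vertices, which is too few. That they
do dominate is shown by switching ends of matching edges outside `C` (`exists_partial_transversal`).

Sufficiency (`exists_extremal_graph`) uses that `q = 2 * p` is even: `d + 1` disjoint copies of a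
graph on `2 * p` parts without a full transversal, built from complete bipartite graphs with sides
of at most `Δ` vertices. An independent set missing only `d` parts would be a full transversal of
some copy.

The minimum degree version follows by complementing inside the complete multipartite graph. -/

/-! ### Rainbow independent sets and domination by absorbed stars. -/

section Transversals

variable {V ι : Type*} [DecidableEq V] [DecidableEq ι]

/-- `T` is an independent set inside `A` with exactly one vertex of each colour in `J` and no other
vertices. -/
structure IsTransversal (G : SimpleGraph V) (c : V → ι) (A : Set V) (J : Finset ι)
    (T : Finset V) : Prop where
  mem : ∀ t ∈ T, t ∈ A
  indep : ∀ s ∈ T, ∀ t ∈ T, ¬ G.Adj s t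
  inj : Set.InjOn c (T : Set V)
  image : T.image c = J

/-- No transversal of the colours `I \ S` inside `A` can be extended by a vertex of `A` with colour
in `S`, although such transversals exist. -/
def Blocked (G : SimpleGraph V) (c : V → ι) (A : Set V) (I S : Finset ι) : Prop :=
  (∃ T, IsTransversal G c A (I \ S) T) ∧
    ∀ T, IsTransversal G c A (I \ S) T → ∀ v ∈ A, c v ∈ S → ∃ t ∈ T, G.Adj v t

variable {G : SimpleGraph V} {c : V → ι} {A : Set V} {I S J J' : Finset ι}

omit [DecidableEq V] in
lemma IsTransversal.color_mem {T : Finset V} (h : IsTransversal G c A J T) {t : V} (ht : t ∈ T) :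
    c t ∈ J := h.image ▸ Finset.mem_image_of_mem c ht

omit [DecidableEq V] in
lemma IsTransversal.card {T : Finset V} (h : IsTransversal G c A J T) : T.card = J.card := by
  rw [← h.image, Finset.card_image_of_injOn h.inj]

omit [DecidableEq V] in
lemma IsTransversal.subset {T U : Finset V} (h : IsTransversal G c A J T) (hU : U ⊆ T)
    {A' : Set V} (hA : ∀ u ∈ U, u ∈ A') : IsTransversal G c A' (U.image c) U :=
  ⟨hA, fun s hs t ht => h.indep s (hU hs) t (hU ht), h.inj.mono (by exact_mod_cast hU), rfl⟩

lemma IsTransversal.union {T U : Finset V} (hT : IsTransversal G c A J T)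
    (hU : IsTransversal G c A J' U) (hJ : Disjoint J J') (hTU : ∀ s ∈ T, ∀ t ∈ U, ¬ G.Adj s t) :
    IsTransversal G c A (J ∪ J') (T ∪ U) := by
  refine ⟨?_, ?_, ?_, ?_⟩
  · intro t ht
    rcases Finset.mem_union.1 ht with h | h
    exacts [hT.mem t h, hU.mem t h]
  · intro s hs t ht
    rcases Finset.mem_union.1 hs with h | h <;> rcases Finset.mem_union.1 ht with h' | h'
    exacts [hT.indep s h t h', hTU s h t h', fun ha => hTU t h' s h ha.symm, hU.indep s h t h']
  · intro s hs t ht hst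
    rw [Finset.mem_coe, Finset.mem_union] at hs ht
    have key : ∀ a ∈ T, ∀ b ∈ U, c a ≠ c b := fun a ha b hb hab =>
      Finset.disjoint_left.1 hJ (hT.color_mem ha) (hab ▸ hU.color_mem hb)
    rcases hs with h | h <;> rcases ht with h' | h'
    exacts [hT.inj h h' hst, (key s h t h' hst).elim, (key t h' s h hst.symm).elim,
      hU.inj h h' hst]
  · rw [Finset.image_union, hT.image, hU.image]

omit [DecidableEq V] in
lemma IsTransversal.singleton {v : V} (hv : v ∈ A) : IsTransversal G c A {c v} {v} :=
  ⟨by simpa using hv, by simp, by simp, by simp⟩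

omit [DecidableEq V] in
lemma IsTransversal.mono {A' : Set V} {T : Finset V} (h : IsTransversal G c A J T)
    (hA : A ⊆ A') : IsTransversal G c A' J T :=
  ⟨fun t ht => hA (h.mem t ht), h.indep, h.inj, h.image⟩

/-- Absorbing a star into a blocked configuration leaves a blocked configuration. -/
lemma Blocked.step (h : Blocked G c A I S) (hne : ∃ v ∈ A, c v ∈ S) :
    ∃ (w : V) (L : Finset V), w ∈ A ∧ c w ∈ S ∧ L.Nonempty ∧ (∀ t ∈ L, G.Adj w t) ∧
      IsTransversal G c A (L.image c) L ∧ L.image c ⊆ I \ S ∧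
      Blocked G c {v ∈ A | ¬ G.Adj w v ∧ ∀ t ∈ L, ¬ G.Adj t v} I (S ∪ L.image c) := by
  classical
  obtain ⟨⟨T₀, hT₀⟩, hb⟩ := h
  obtain ⟨v₀, hv₀, hcv₀⟩ := hne
  -- The pair `T`, `w` is chosen so that `w` has as few neighbours in `T` as possible; these
  -- neighbours are the leaves of the star.
  have hex : ∃ l : ℕ, ∃ T w, IsTransversal G c A (I \ S) T ∧ w ∈ A ∧ c w ∈ S ∧
      (T.filter (G.Adj w)).card = l := ⟨_, T₀, v₀, hT₀, hv₀, hcv₀, rfl⟩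
  obtain ⟨T, w, hT, hw, hcw, hl⟩ := Nat.find_spec hex
  have hmin : ∀ T' , IsTransversal G c A (I \ S) T' →
      (T.filter (G.Adj w)).card ≤ (T'.filter (G.Adj w)).card := fun T' hT' =>
    hl ▸ Nat.find_min' hex ⟨T', w, hT', hw, hcw, rfl⟩
  set L := T.filter (G.Adj w) with hL
  have hLT : L ⊆ T := Finset.filter_subset _ _
  have hLtr : IsTransversal G c A (L.image c) L := hT.subset hLT fun u hu => hT.mem u (hLT hu)
  have hLI : L.image c ⊆ I \ S := hT.image ▸ Finset.image_subset_image hLT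
  have hLne : L.Nonempty := by
    obtain ⟨t, ht, hwt⟩ := hb T hT w hw hcw
    exact ⟨t, Finset.mem_filter.2 ⟨ht, hwt⟩⟩
  have hsplit : (I \ (S ∪ L.image c)) ∪ L.image c = I \ S := by
    ext p
    have := @hLI p
    simp only [Finset.mem_union, Finset.mem_sdiff] at this ⊢
    tauto
  have hdisj : Disjoint (I \ (S ∪ L.image c)) (L.image c) := by
    rw [Finset.disjoint_left]
    intro p hp
    simp only [Finset.mem_union, Finset.mem_sdiff] at hp
    tauto
  refine ⟨w, L, hw, hcw, hLne, fun t ht => (Finset.mem_filter.1 ht).2, hLtr, hLI, ?_, ?_⟩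
  · refine ⟨T \ L, ?_⟩
    have h1 : IsTransversal G c {v ∈ A | ¬ G.Adj w v ∧ ∀ t ∈ L, ¬ G.Adj t v}
        ((T \ L).image c) (T \ L) := by
      refine hT.subset Finset.sdiff_subset ?_
      intro u hu
      rw [Finset.mem_sdiff] at hu
      refine ⟨hT.mem u hu.1, fun ha => hu.2 (Finset.mem_filter.2 ⟨hu.1, ha⟩), fun t ht => ?_⟩
      exact hT.indep t (hLT ht) u hu.1
    have h2 : (T \ L).image c = I \ (S ∪ L.image c) := by
      rw [Finset.image_sdiff_of_injOn hT.inj hLT, hT.image, Finset.sdiff_sdiff_left']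
      ext p; simp only [Finset.mem_inter, Finset.mem_sdiff, Finset.mem_union]; tauto
    rwa [h2] at h1
  · intro T' hT' v hv hcv
    by_contra! hno
    have hT'A : IsTransversal G c A _ T' := hT'.mono fun v hv => hv.1
    have hun := hT'A.union hLtr hdisj fun s hs t ht ha => (hT'.mem s hs).2.2 t ht ha.symm
    rw [hsplit] at hun
    by_cases hvS : c v ∈ S
    · obtain ⟨t, ht, hvt⟩ := hb _ hun v hv.1 hvS
      rcases Finset.mem_union.1 ht with h | h
      exacts [hno t h hvt, hv.2.2 t h hvt.symm]
    -- If `v` has the colour of a leaf `t`, exchanging `t` for `v` gives a transversal with fewer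
    -- neighbours of `w`, against minimality.
    · have hcvL : c v ∈ L.image c := by
        rcases Finset.mem_union.1 hcv with h | h
        exacts [(hvS h).elim, h]
      obtain ⟨t, ht, htv⟩ := Finset.mem_image.1 hcvL
      have hLt : IsTransversal G c A ((L.erase t).image c) (L.erase t) :=
        hLtr.subset (Finset.erase_subset _ _) fun u hu => hLtr.mem u (Finset.mem_of_mem_erase hu)
      have himg : (L.erase t).image c ∪ {c v} = L.image c := by
        rw [← htv, Finset.union_comm, ← Finset.image_singleton, ← Finset.image_union,
          ← Finset.insert_eq, Finset.insert_erase ht]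
      have hvL : IsTransversal G c A (L.image c) (L.erase t ∪ {v}) := by
        rw [← himg]
        refine hLt.union (IsTransversal.singleton hv.1) ?_ ?_
        · rw [Finset.disjoint_singleton_right, ← htv]
          intro hmem
          obtain ⟨u, hu, hut⟩ := Finset.mem_image.1 hmem
          exact Finset.ne_of_mem_erase hu (hLtr.inj (Finset.mem_of_mem_erase hu) ht hut)
        · intro s hs u hu
          rw [Finset.mem_singleton.1 hu]
          exact hv.2.2 s (Finset.mem_of_mem_erase hs)
      have hun2 := hT'A.union hvL hdisj (by
        intro s hs u hu ha
        rcases Finset.mem_union.1 hu with h | h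
        · exact (hT'.mem s hs).2.2 u (Finset.mem_of_mem_erase h) ha.symm
        · rw [Finset.mem_singleton.1 h] at ha
          exact hno s hs ha.symm)
      rw [hsplit] at hun2
      have hle := hmin _ hun2
      have hsub : (T' ∪ (L.erase t ∪ {v})).filter (G.Adj w) ⊆ L.erase t := by
        intro u hu
        rw [Finset.mem_filter, Finset.mem_union, Finset.mem_union, Finset.mem_singleton] at hu
        rcases hu with ⟨h | h | h, ha⟩
        · exact ((hT'.mem u h).2.1 ha).elim
        · exact h
        · exact (hv.2.1 (h ▸ ha)).elim
      have h1 := Finset.card_le_card hsub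
      have h2 := Finset.card_erase_lt_of_mem ht
      omega

/-- A blocked configuration grows to a set of colours that is dominated by few vertices. -/
lemma Blocked.exists_dominating (hS : S ⊆ I) (h : Blocked G c A I S) :
    ∃ (S' : Finset ι) (X : Finset V), S ⊆ S' ∧ S' ⊆ I ∧
      (∀ v ∈ A, c v ∈ S' → ∃ x ∈ X, G.Adj x v) ∧ X.card + 2 * S.card ≤ 2 * S'.card := by
  induction hm : (I \ S).card using Nat.strong_induction_on generalizing S A with
  | _ m ih =>
  by_cases hne : ∃ v ∈ A, c v ∈ S
  · obtain ⟨w, L, hw, hcw, hLne, hwL, hLtr, hLI, hb⟩ := h.step hne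
    have hS1 : S ∪ L.image c ⊆ I :=
      Finset.union_subset hS (hLI.trans Finset.sdiff_subset)
    have hdisj : Disjoint S (L.image c) := by
      rw [Finset.disjoint_right]
      intro p hp
      exact (Finset.mem_sdiff.1 (hLI hp)).2
    have hcard : (S ∪ L.image c).card = S.card + L.card := by
      rw [Finset.card_union_of_disjoint hdisj, hLtr.card]
    have hpos := hLne.card_pos
    have e1 := Finset.card_sdiff_add_card_eq_card hS
    have e2 := Finset.card_sdiff_add_card_eq_card hS1
    obtain ⟨S', X, h1, h2, h3, h4⟩ := ih _ (by omega) hS1 hb rfl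
    refine ⟨S', insert w (L ∪ X), Finset.subset_union_left.trans h1, h2, ?_, ?_⟩
    · intro v hv hcv
      by_cases hvw : G.Adj w v
      · exact ⟨w, Finset.mem_insert_self _ _, hvw⟩
      by_cases hvL : ∃ t ∈ L, G.Adj t v
      · obtain ⟨t, ht, htv⟩ := hvL
        exact ⟨t, by simp [ht], htv⟩
      · push Not at hvL
        obtain ⟨x, hx, hxv⟩ := h3 v ⟨hv, hvw, hvL⟩ hcv
        exact ⟨x, by simp [hx], hxv⟩
    -- The star costs `1 + |L| ≤ 2 * |L|` vertices and brings `|L|` new colours.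
    · have := Finset.card_insert_le w (L ∪ X)
      have := Finset.card_union_le L X
      omega
  · push Not at hne
    exact ⟨S, ∅, subset_rfl, hS, fun v hv hc => (hne v hv hc).elim, by simp⟩

/-- Take a largest rainbow independent set; it is blocked by any set of missed colours. -/
lemma exists_blocked (G : SimpleGraph V) (c : V → ι) (A : Set V) (I : Finset ι) (m : ℕ)
    (_hm : m ≤ I.card)
    (hno : ∀ J ⊆ I, ∀ T, IsTransversal G c A J T → J.card + m ≤ I.card) :
    ∃ I' S, S ⊆ I' ∧ I' ⊆ I ∧ S.card = m ∧ Blocked G c A I' S := by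
  classical
  have hP0 : IsTransversal G c A ∅ ∅ := ⟨by simp, by simp, by simp, by simp⟩
  obtain ⟨J, hJ, hmax⟩ := Finset.exists_max_image
    (I.powerset.filter fun J => ∃ T, IsTransversal G c A J T) Finset.card
    ⟨∅, by simpa using ⟨_, hP0⟩⟩
  rw [Finset.mem_filter, Finset.mem_powerset] at hJ
  obtain ⟨hJI, T, hT⟩ := hJ
  have hc := hno J hJI T hT
  have e1 := Finset.card_sdiff_add_card_eq_card hJI
  -- The remaining missed colours are discarded, so that the transversals in question are those of
  -- the maximal set `J`.
  obtain ⟨S, hS, hSm⟩ := Finset.exists_subset_card_eq (s := I \ J) (n := m) (by omega)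
  have hdis : Disjoint J S := by
    rw [Finset.disjoint_right]; intro p hp; exact (Finset.mem_sdiff.1 (hS hp)).2
  have hJS : (J ∪ S) \ S = J := by
    rw [Finset.union_sdiff_right, Finset.sdiff_eq_self_of_disjoint hdis]
  refine ⟨J ∪ S, S, Finset.subset_union_right,
    Finset.union_subset hJI (hS.trans Finset.sdiff_subset), hSm, ?_⟩
  rw [Blocked, hJS]
  refine ⟨⟨T, hT⟩, fun T' hT' v hv hcv => ?_⟩
  by_contra! hno'
  have hcvJ : c v ∉ J := (Finset.mem_sdiff.1 (hS hcv)).2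
  have hun := hT'.union (IsTransversal.singleton (G := G) (c := c) hv)
    (by simpa using hcvJ) (by
      intro s hs t ht ha
      rw [Finset.mem_singleton.1 ht] at ha
      exact hno' s hs ha.symm)
  have := hmax (J ∪ {c v}) (by
    rw [Finset.mem_filter, Finset.mem_powerset]
    refine ⟨Finset.union_subset hJI ?_, _, hun⟩
    rw [Finset.singleton_subset_iff]
    exact (Finset.mem_sdiff.1 (hS hcv)).1)
  rw [Finset.card_union_of_disjoint (by simpa using hcvJ), Finset.card_singleton] at this
  omega

end Transversals

/-! ### Haxell's theorem and induced matchings that are forests on the colours. -/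

section Matchings

variable {V ι : Type*} [DecidableEq V] [DecidableEq ι]

lemma card_le_of_dominated [Fintype V] {G : SimpleGraph V} [DecidableRel G.Adj] {Δ : ℕ}
    (hdeg : ∀ v, G.degree v ≤ Δ) {U X : Finset V} (h : ∀ u ∈ U, ∃ x ∈ X, G.Adj x u) :
    U.card ≤ Δ * X.card := by
  have hsub : U ⊆ X.biUnion fun x => G.neighborFinset x := by
    intro u hu
    obtain ⟨x, hx, hxu⟩ := h u hu
    exact Finset.mem_biUnion.2 ⟨x, hx, by simpa using hxu⟩
  rw [mul_comm]
  exact (Finset.card_le_card hsub).trans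
    (Finset.card_biUnion_le_card_mul _ _ _ fun x _ => hdeg x)

/-- Haxell's condition for full independent transversals, with colour classes of varying size. -/
lemma exists_transversal [Fintype V] {G : SimpleGraph V} [DecidableRel G.Adj] {c : V → ι} {Δ : ℕ}
    (hdeg : ∀ v, G.degree v ≤ Δ) (A : Finset V) (I : Finset ι)
    (h : ∀ D ⊆ I, D.Nonempty → 2 * Δ * D.card < (A.filter fun v => c v ∈ D).card + 2 * Δ) :
    ∃ T, IsTransversal G c A I T := by
  by_contra hno
  have hI : I ≠ ∅ := by
    rintro rfl
    exact hno ⟨∅, by simp, by simp, by simp, by simp⟩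
  have hpos : 1 ≤ I.card := Finset.card_pos.2 (Finset.nonempty_iff_ne_empty.2 hI)
  obtain ⟨I', S, hSI', hI'I, hS1, hb⟩ := exists_blocked G c (A : Set V) I 1 hpos (by
    intro J hJ T hT
    refine Finset.card_lt_card (hJ.ssubset_of_ne ?_)
    rintro rfl
    exact hno ⟨T, hT⟩)
  obtain ⟨S', X, h1, h2, h3, h4⟩ := hb.exists_dominating hSI'
  have hne : S'.Nonempty := (Finset.card_pos.1 (by omega : 0 < S.card)).mono h1
  have hlt := h S' (h2.trans hI'I) hne
  have hle := card_le_of_dominated hdeg (U := A.filter fun v => c v ∈ S') (X := X) (by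
    intro u hu
    rw [Finset.mem_filter] at hu
    exact h3 u hu.1 hu.2)
  -- With one missed colour, the dominating set has at most `2 * (|S'| - 1)` vertices.
  have : Δ * X.card + Δ * 2 ≤ Δ * (2 * S'.card) := by
    rw [← mul_add]
    exact Nat.mul_le_mul_left _ (by omega)
  nlinarith

/-- The equivalence relation on colours generated by the edges inside `B`. -/
def Linked (G : SimpleGraph V) (c : V → ι) (B : Finset V) : ι → ι → Prop :=
  Relation.EqvGen fun p q => ∃ x ∈ B, ∃ y ∈ B, G.Adj x y ∧ c x = p ∧ c y = q

/-- An induced matching with vertex set `B`, every edge of which is a bridge in the multigraph that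
arises by contracting each colour class to a point. -/
structure IsForestMatching (G : SimpleGraph V) (c : V → ι) (B : Finset V) : Prop where
  mate : ∀ x ∈ B, ∃ y ∈ B, G.Adj x y
  unique : ∀ x ∈ B, ∀ y ∈ B, ∀ z ∈ B, G.Adj x y → G.Adj x z → y = z
  bridge : ∀ x ∈ B, ∀ y ∈ B, G.Adj x y → ¬ Linked G c (B \ {x, y}) (c x) (c y)

variable {G : SimpleGraph V} {c : V → ι} {B B' B₀ : Finset V} {x y z : V} {p q s : ι}

omit [DecidableEq V] [DecidableEq ι] in
lemma Linked.refl : Linked G c B p p := Relation.EqvGen.refl p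

omit [DecidableEq V] [DecidableEq ι] in
lemma Linked.symm (h : Linked G c B p q) : Linked G c B q p := Relation.EqvGen.symm _ _ h

omit [DecidableEq V] [DecidableEq ι] in
lemma Linked.trans (h : Linked G c B p q) (h' : Linked G c B q s) : Linked G c B p s :=
  Relation.EqvGen.trans _ _ _ h h'

omit [DecidableEq V] [DecidableEq ι] in
lemma Linked.of_adj (hx : x ∈ B) (hy : y ∈ B) (h : G.Adj x y) : Linked G c B (c x) (c y) :=
  Relation.EqvGen.rel _ _ ⟨x, hx, y, hy, h, rfl, rfl⟩

omit [DecidableEq V] [DecidableEq ι] in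
lemma Linked.mono (hB : B ⊆ B') (h : Linked G c B p q) : Linked G c B' p q := by
  induction h with
  | rel p q h =>
    obtain ⟨x, hx, y, hy, h⟩ := h
    exact .rel _ _ ⟨x, hB hx, y, hB hy, h⟩
  | refl p => exact .refl
  | symm p q _ ih => exact ih.symm
  | trans p q s _ _ ih ih' => exact ih.trans ih'

omit [DecidableEq V] [DecidableEq ι] in
/-- A link either avoids the edge `xy` or can be cut at it. -/
lemma Linked.cases_edge (hB : ∀ u ∈ B, ∀ v ∈ B, G.Adj u v →
    (u ∈ B₀ ∧ v ∈ B₀) ∨ (u = x ∧ v = y) ∨ (u = y ∧ v = x)) (h : Linked G c B p q) :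
    Linked G c B₀ p q ∨ (Linked G c B₀ p (c x) ∧ Linked G c B₀ (c y) q) ∨
      (Linked G c B₀ p (c y) ∧ Linked G c B₀ (c x) q) := by
  induction h with
  | rel p q h =>
    obtain ⟨u, hu, v, hv, ha, rfl, rfl⟩ := h
    rcases hB u hu v hv ha with h | ⟨rfl, rfl⟩ | ⟨rfl, rfl⟩
    exacts [.inl (.of_adj h.1 h.2 ha), .inr (.inl ⟨.refl, .refl⟩), .inr (.inr ⟨.refl, .refl⟩)]
  | refl p => exact .inl .refl
  | symm p q _ ih =>
    rcases ih with h | ⟨h, h'⟩ | ⟨h, h'⟩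
    exacts [.inl h.symm, .inr (.inr ⟨h'.symm, h.symm⟩), .inr (.inl ⟨h'.symm, h.symm⟩)]
  | trans p q s _ _ ih ih' =>
    rcases ih with h | ⟨h, h'⟩ | ⟨h, h'⟩ <;> rcases ih' with k | ⟨k, k'⟩ | ⟨k, k'⟩
    exacts [.inl (h.trans k), .inr (.inl ⟨h.trans k, k'⟩), .inr (.inr ⟨h.trans k, k'⟩),
      .inr (.inl ⟨h, h'.trans k⟩), .inr (.inl ⟨h, k'⟩), .inl (h.trans k'),
      .inr (.inr ⟨h, h'.trans k⟩), .inl (h.trans k'), .inr (.inr ⟨h, k'⟩)]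

omit [DecidableEq V] in
/-- Colours that carry no vertex of `B` are linked to themselves only. -/
lemma Linked.eq_of_notMem (hp : p ∉ B.image c) (h : Linked G c B p q) : p = q := by
  have key : ∀ p q, Linked G c B p q → p = q ∨ (p ∈ B.image c ∧ q ∈ B.image c) := by
    intro p q h
    induction h with
    | rel p q h =>
      obtain ⟨u, hu, v, hv, ha, rfl, rfl⟩ := h
      exact .inr ⟨Finset.mem_image_of_mem _ hu, Finset.mem_image_of_mem _ hv⟩
    | refl p => exact .inl rfl
    | symm p q _ ih => tauto
    | trans p q s _ _ ih ih' =>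
      rcases ih with rfl | h
      · exact ih'
      · rcases ih' with rfl | h'
        exacts [.inr h, .inr ⟨h.1, h'.2⟩]
  rcases key p q h with h | h
  exacts [h, (hp h.1).elim]

omit [DecidableEq V] [DecidableEq ι] in
lemma Linked.mem_iff {C : Finset ι}
    (hC : ∀ u ∈ B, ∀ v ∈ B, G.Adj u v → c u ∈ C → c v ∈ C) (h : Linked G c B p q) :
    p ∈ C ↔ q ∈ C := by
  induction h with
  | rel p q h =>
    obtain ⟨u, hu, v, hv, ha, rfl, rfl⟩ := h
    exact ⟨hC u hu v hv ha, hC v hv u hu ha.symm⟩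
  | refl p => rfl
  | symm p q _ ih => exact ih.symm
  | trans p q s _ _ ih ih' => exact ih.trans ih'

namespace IsForestMatching

omit [DecidableEq ι] in
lemma pair_cases (h : IsForestMatching G c B) (hx : x ∈ B) (hy : y ∈ B) (hxy : G.Adj x y) :
    ∀ u ∈ B, ∀ v ∈ B, G.Adj u v →
      (u ∈ B \ {x, y} ∧ v ∈ B \ {x, y}) ∨ (u = x ∧ v = y) ∨ (u = y ∧ v = x) := by
  intro u hu v hv ha
  by_cases hux : u = x
  · subst hux; exact .inr (.inl ⟨rfl, h.unique u hu v hv y hy ha hxy⟩)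
  by_cases huy : u = y
  · subst huy; exact .inr (.inr ⟨rfl, h.unique u hu v hv x hx ha hxy.symm⟩)
  by_cases hvx : v = x
  · subst hvx; exact (huy (h.unique v hv u hu y hy ha.symm hxy)).elim
  by_cases hvy : v = y
  · subst hvy; exact (hux (h.unique v hv u hu x hx ha.symm hxy.symm)).elim
  · exact .inl ⟨by simp [hu, hux, huy], by simp [hv, hvx, hvy]⟩

omit [DecidableEq ι] in
lemma erase (h : IsForestMatching G c B) (hx : x ∈ B) (hy : y ∈ B) (hxy : G.Adj x y) :
    IsForestMatching G c (B \ {x, y}) := by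
  have hsub : B \ {x, y} ⊆ B := Finset.sdiff_subset
  refine ⟨fun u hu => ?_, fun u hu v hv w hw => h.unique u (hsub hu) v (hsub hv) w (hsub hw),
    fun u hu v hv ha hl => h.bridge u (hsub hu) v (hsub hv) ha
      (hl.mono (Finset.sdiff_subset_sdiff hsub subset_rfl))⟩
  obtain ⟨v, hv, ha⟩ := h.mate u (hsub hu)
  rcases h.pair_cases hx hy hxy u (hsub hu) v hv ha with h | ⟨rfl, -⟩ | ⟨rfl, -⟩
  · exact ⟨v, h.2, ha⟩
  · simp at hu
  · simp at hu

omit [DecidableEq ι] in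
lemma card_erase (hx : x ∈ B) (hy : y ∈ B) (hxy : G.Adj x y) :
    (B \ {x, y}).card + 2 = B.card := by
  rw [← Finset.card_pair hxy.ne]
  exact Finset.card_sdiff_add_card_eq_card (by
    intro u hu; rcases Finset.mem_insert.1 hu with rfl | hu
    exacts [hx, Finset.mem_singleton.1 hu ▸ hy])

omit [DecidableEq ι] in
/-- Half of the vertices of a forest matching form a rainbow independent set avoiding any given set
of pairwise unlinked colours. -/
lemma exists_selection (h : IsForestMatching G c B) (R : Set ι)
    (hR : ∀ p ∈ R, ∀ q ∈ R, Linked G c B p q → p = q) :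
    ∃ T ⊆ B, (∀ s ∈ T, ∀ t ∈ T, ¬ G.Adj s t) ∧ Set.InjOn c (T : Set V) ∧ (∀ t ∈ T, c t ∉ R) ∧
      2 * T.card = B.card := by
  induction hm : B.card using Nat.strong_induction_on generalizing B R with
  | _ m ih =>
  subst hm
  rcases B.eq_empty_or_nonempty with rfl | ⟨x, hx⟩
  · exact ⟨∅, by simp⟩
  obtain ⟨y, hy, hxy⟩ := h.mate x hx
  -- Each edge contributes its end away from the root in `R`. Once `xy` is deleted and `x` selected,
  -- `c x` becomes the root of its own tree.
  have main : ∀ x ∈ B, ∀ y ∈ B, G.Adj x y → (∀ ρ ∈ R, ¬ Linked G c (B \ {x, y}) ρ (c x)) →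
      ∃ T ⊆ B, (∀ s ∈ T, ∀ t ∈ T, ¬ G.Adj s t) ∧ Set.InjOn c (T : Set V) ∧ (∀ t ∈ T, c t ∉ R) ∧
        2 * T.card = B.card := by
    intro x hx y hy hxy hno
    have hsub : B \ {x, y} ⊆ B := Finset.sdiff_subset
    have hcard := card_erase hx hy hxy
    obtain ⟨T, hT, hind, hinj, hav, hTc⟩ := ih _ (by omega) (h.erase hx hy hxy) (insert (c x) R)
      (by
        intro p hp q hq hpq
        rcases hp with rfl | hp <;> rcases hq with rfl | hq
        · rfl
        · exact (hno q hq hpq.symm).elim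
        · exact (hno p hp hpq).elim
        · exact hR p hp q hq (hpq.mono hsub)) rfl
    have hxT : x ∉ T := fun hx' => by have := hT hx'; simp at this
    have hnx : ∀ t ∈ T, ¬ G.Adj x t := by
      intro t ht ha
      have := h.unique x hx t (hsub (hT ht)) y hy ha hxy
      subst this
      have := hT ht; simp at this
    refine ⟨insert x T, ?_, ?_, ?_, ?_, ?_⟩
    · exact Finset.insert_subset hx (hT.trans hsub)
    · intro s hs t ht ha
      rcases Finset.mem_insert.1 hs with h1 | h1 <;> rcases Finset.mem_insert.1 ht with h2 | h2
      · exact G.irrefl (h1 ▸ h2 ▸ ha)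
      · exact hnx t h2 (h1 ▸ ha)
      · exact hnx s h1 (h2 ▸ ha.symm)
      · exact hind s h1 t h2 ha
    · rw [Finset.coe_insert, Set.injOn_insert (by simpa using hxT)]
      refine ⟨hinj, ?_⟩
      rintro ⟨t, ht, htx⟩
      exact hav t ht (.inl htx)
    · intro t ht
      rcases Finset.mem_insert.1 ht with rfl | ht
      · exact fun hR' => hno _ hR' .refl
      · exact fun hR' => hav t ht (.inr hR')
    · rw [Finset.card_insert_of_notMem hxT]; omega
  by_cases h1 : ∃ ρ ∈ R, Linked G c (B \ {x, y}) ρ (c x)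
  · refine main y hy x hx hxy.symm fun ρ' hρ' hl' => ?_
    rw [Finset.pair_comm] at hl'
    obtain ⟨ρ, hρ, hl⟩ := h1
    -- If both sides of `xy` contained a root, the two roots would coincide, as they are linked
    -- through `xy`; then `xy` would not be a bridge.
    have hsub : B \ {x, y} ⊆ B := Finset.sdiff_subset
    have : ρ = ρ' := hR ρ hρ ρ' hρ'
      (((hl.mono hsub).trans (.of_adj hx hy hxy)).trans (hl'.mono hsub).symm)
    subst this
    exact h.bridge x hx y hy hxy (hl.symm.trans hl')
  · push Not at h1
    exact main x hx y hy hxy h1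

/-- Adding a pendant edge `wt` whose end `t` has a new colour. -/
lemma insert_leaf (h : IsForestMatching G c B) {w t : V} (hwt : G.Adj w t)
    (hw : ∀ b ∈ B, ¬ G.Adj b w) (ht : ∀ b ∈ B, ¬ G.Adj b t) (htB : c t ∉ B.image c)
    (hct : c w ≠ c t) : IsForestMatching G c (insert w (insert t B)) := by
  have hcase : ∀ u ∈ insert w (insert t B), ∀ v ∈ insert w (insert t B), G.Adj u v →
      (u ∈ B ∧ v ∈ B) ∨ (u = w ∧ v = t) ∨ (u = t ∧ v = w) := by
    intro u hu v hv ha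
    rw [Finset.mem_insert, Finset.mem_insert] at hu hv
    rcases hu with rfl | rfl | hu <;> rcases hv with rfl | rfl | hv
    exacts [(G.irrefl ha).elim, .inr (.inl ⟨rfl, rfl⟩), (hw _ hv ha.symm).elim,
      .inr (.inr ⟨rfl, rfl⟩), (G.irrefl ha).elim, (ht _ hv ha.symm).elim,
      (hw _ hu ha).elim, (ht _ hu ha).elim, .inl ⟨hu, hv⟩]
  have hwB : w ∉ B := fun hwB => by
    obtain ⟨b, hb, hwb⟩ := h.mate w hwB
    exact hw b hb hwb.symm
  have htB' : t ∉ B := fun htB' => htB (Finset.mem_image_of_mem c htB')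
  refine ⟨fun u hu => ?_, fun u hu v hv v' hv' ha ha' => ?_, fun u hu v hv ha hl => ?_⟩
  · rw [Finset.mem_insert, Finset.mem_insert] at hu
    rcases hu with rfl | rfl | hu
    · exact ⟨t, by simp, hwt⟩
    · exact ⟨w, by simp, hwt.symm⟩
    · obtain ⟨v, hv, ha⟩ := h.mate u hu
      exact ⟨v, by simp [hv], ha⟩
  · rcases hcase u hu v hv ha with ⟨h1, h2⟩ | ⟨rfl, rfl⟩ | ⟨rfl, rfl⟩ <;>
      rcases hcase u hu v' hv' ha' with ⟨k1, k2⟩ | ⟨k1, rfl⟩ | ⟨k1, rfl⟩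
    exacts [h.unique u h1 v h2 v' k2 ha ha', (hwB (k1 ▸ h1)).elim, (htB' (k1 ▸ h1)).elim,
      (hwB k1).elim, rfl, (hwt.ne k1).elim, (htB' k1).elim, (hwt.ne k1.symm).elim, rfl]
  · have hBe : insert w (insert t B) \ {w, t} = B := by
      ext b
      simp only [Finset.mem_sdiff, Finset.mem_insert, Finset.mem_singleton]
      constructor
      · tauto
      · intro hb
        exact ⟨by tauto, by rintro (rfl | rfl) <;> contradiction⟩
    have hno : ¬ Linked G c B (c w) (c t) := fun hl =>
      hct (Linked.eq_of_notMem htB hl.symm).symm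
    rcases hcase u hu v hv ha with ⟨h1, h2⟩ | ⟨rfl, rfl⟩ | ⟨rfl, rfl⟩
    · have hsub : B \ {u, v} ⊆ B := Finset.sdiff_subset
      have hc : c t ∉ (B \ {u, v}).image c := fun hm => htB (Finset.image_subset_image hsub hm)
      have htu : c t ≠ c u := fun he => htB (he ▸ Finset.mem_image_of_mem c h1)
      have htv : c t ≠ c v := fun he => htB (he ▸ Finset.mem_image_of_mem c h2)
      -- A link using the new edge would have to end in the colour of `t`, which is a dead end.
      rcases hl.cases_edge (B₀ := B \ {u, v}) (x := w) (y := t) (by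
          intro a ha b hb hab
          rw [Finset.mem_sdiff] at ha hb
          rcases hcase a ha.1 b hb.1 hab with hh | hh
          · exact .inl ⟨Finset.mem_sdiff.2 ⟨hh.1, ha.2⟩, Finset.mem_sdiff.2 ⟨hh.2, hb.2⟩⟩
          · exact .inr hh) with hl | ⟨-, hl⟩ | ⟨hl, -⟩
      · exact h.bridge u h1 v h2 ha hl
      · exact htv (hl.eq_of_notMem hc)
      · exact htu (hl.symm.eq_of_notMem hc)
    · rw [hBe] at hl; exact hno hl
    · rw [Finset.pair_comm, hBe] at hl; exact hno hl.symm

omit [DecidableEq ι] in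
/-- Replacing the end `y` of the edge `xy` by another vertex `z` with the same only neighbour `x`
that lies on the same side of the edge. -/
lemma switch (h : IsForestMatching G c B) (hx : x ∈ B) (hy : y ∈ B) (hxy : G.Adj x y)
    (hxz : G.Adj x z) (hz : ∀ b ∈ B, G.Adj b z → b = x)
    (hl : Linked G c (B \ {x, y}) (c z) (c y)) :
    IsForestMatching G c (insert z (B.erase y)) := by
  have hcase : ∀ u ∈ insert z (B.erase y), ∀ v ∈ insert z (B.erase y), G.Adj u v →
      (u ∈ B \ {x, y} ∧ v ∈ B \ {x, y}) ∨ (u = x ∧ v = z) ∨ (u = z ∧ v = x) := by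
    intro u hu v hv ha
    rw [Finset.mem_insert, Finset.mem_erase] at hu hv
    rcases hu with rfl | hu <;> rcases hv with rfl | hv
    · exact (G.irrefl ha).elim
    · exact .inr (.inr ⟨rfl, hz v hv.2 ha.symm⟩)
    · exact .inr (.inl ⟨hz u hu.2 ha, rfl⟩)
    · rcases h.pair_cases hx hy hxy u hu.2 v hv.2 ha with hh | hh | hh
      exacts [.inl hh, (hv.1 hh.2).elim, (hu.1 hh.1).elim]
  have hzB0 : z ∉ B \ {x, y} := by
    intro hzB
    rw [Finset.mem_sdiff] at hzB
    obtain ⟨b, hb, hzb⟩ := h.mate z hzB.1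
    have hbx := hz b hb hzb.symm
    subst hbx
    have := h.unique b hb z hzB.1 y hy hxz hxy
    subst this
    simp at hzB
  have hBe : insert z (B.erase y) \ {x, z} = B \ {x, y} := by
    ext b
    simp only [Finset.mem_sdiff, Finset.mem_insert, Finset.mem_singleton, Finset.mem_erase]
      at hzB0 ⊢
    constructor
    · tauto
    · rintro ⟨hb, hb'⟩
      refine ⟨.inr ⟨by tauto, hb⟩, ?_⟩
      rintro (rfl | rfl) <;> tauto
  have hbr := h.bridge x hx y hy hxy
  have hno : ¬ Linked G c (B \ {x, y}) (c x) (c z) := fun hl' => hbr (hl'.trans hl)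
  refine ⟨fun u hu => ?_, fun u hu v hv v' hv' ha ha' => ?_, fun u hu v hv ha hl1 => ?_⟩
  · have hxm : x ∈ insert z (B.erase y) := by simp [hx, hxy.ne]
    by_cases hux : u = x
    · exact ⟨z, by simp, hux ▸ hxz⟩
    rw [Finset.mem_insert, Finset.mem_erase] at hu
    rcases hu with rfl | hu
    · exact ⟨x, hxm, hxz.symm⟩
    · obtain ⟨v, hv, ha⟩ := h.mate u hu.2
      rcases h.pair_cases hx hy hxy u hu.2 v hv ha with hh | hh | hh
      · refine ⟨v, ?_, ha⟩
        have := hh.2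
        simp at this
        simp [this]
      · exact (hux hh.1).elim
      · exact (hu.1 hh.1).elim
  · have hxB0 : x ∉ B \ {x, y} := by simp
    have hxz' := hxz.ne
    rcases hcase u hu v hv ha with ⟨h1, h2⟩ | ⟨h1, h2⟩ | ⟨h1, h2⟩ <;>
      rcases hcase u hu v' hv' ha' with ⟨k1, k2⟩ | ⟨k1, k2⟩ | ⟨k1, k2⟩
    · exact h.unique u (Finset.sdiff_subset h1) v (Finset.sdiff_subset h2) v'
        (Finset.sdiff_subset k2) ha ha'
    all_goals first
      | exact h2.trans k2.symm
      | (subst k1; contradiction)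
      | (subst h1; contradiction)
  · rcases hcase u hu v hv ha with ⟨h1, h2⟩ | ⟨rfl, rfl⟩ | ⟨rfl, rfl⟩
    · have huB := Finset.sdiff_subset h1
      have hvB := Finset.sdiff_subset h2
      set B₁ := (B \ {x, y}) \ {u, v} with hB₁
      have hB₁sub : B₁ ⊆ B \ {x, y} := Finset.sdiff_subset
      have hB₁sub' : B₁ ⊆ B \ {u, v} :=
        Finset.sdiff_subset_sdiff Finset.sdiff_subset subset_rfl
      have huv : Linked G c (B \ {x, y}) (c u) (c v) := .of_adj h1 h2 ha
      -- If the link passes through `xz`, closing it up with the edge `uv` links `c x` to `c z`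
      -- without `xz`, which the old bridge `xy` excludes.
      rcases hl1.cases_edge (B₀ := B₁) (x := x) (y := z) (by
          intro a ha b hb hab
          rw [Finset.mem_sdiff] at ha hb
          rcases hcase a ha.1 b hb.1 hab with hh | hh
          · exact .inl ⟨Finset.mem_sdiff.2 ⟨hh.1, ha.2⟩, Finset.mem_sdiff.2 ⟨hh.2, hb.2⟩⟩
          · exact .inr hh) with hl2 | ⟨k, k'⟩ | ⟨k, k'⟩
      · exact h.bridge u huB v hvB ha (hl2.mono hB₁sub')
      · exact hno (((k.mono hB₁sub).symm.trans huv).trans (k'.mono hB₁sub).symm)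
      · exact hno (((k'.mono hB₁sub).trans huv.symm).trans (k.mono hB₁sub))
    · rw [hBe] at hl1; exact hno hl1
    · rw [Finset.pair_comm, hBe] at hl1; exact hno hl1.symm

end IsForestMatching

end Matchings

/-! ### Dominating forests and their local structure. -/

section Extremal

variable {V ι : Type*} [DecidableEq V] [DecidableEq ι]
variable {G : SimpleGraph V} {c : V → ι} {B : Finset V} {S I : Finset ι} {x y z : V} {p : ι}

namespace IsForestMatching

/-- A forest matching inside a blocked configuration grows to a dominating one, unless the growth
meets a star with at least two leaves, in which case few vertices dominate. -/
lemma grow (h : IsForestMatching G c B) (hBS : ∀ b ∈ B, c b ∈ S) (hS : S ⊆ I)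
    (hb : Blocked G c {v | ∀ b ∈ B, ¬ G.Adj b v} I S) :
    ∃ S', S ⊆ S' ∧ S' ⊆ I ∧ ((∃ v, c v ∈ S ∧ ∀ b ∈ B, ¬ G.Adj b v) → S ≠ S') ∧
      ((∃ X : Finset V, (∀ v, c v ∈ S' → ∃ x ∈ X, G.Adj x v) ∧
          X.card + 1 + 2 * S.card ≤ 2 * S'.card + B.card) ∨
        (∃ B' : Finset V, IsForestMatching G c B' ∧ (∀ b ∈ B', c b ∈ S') ∧
          (∀ v, c v ∈ S' → ∃ x ∈ B', G.Adj x v) ∧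
          B'.card + 2 * S.card = 2 * S'.card + B.card)) := by
  induction hm : (I \ S).card using Nat.strong_induction_on generalizing S B with
  | _ m ih =>
  subst hm
  by_cases hne : ∃ v ∈ {v | ∀ b ∈ B, ¬ G.Adj b v}, c v ∈ S
  swap
  · have hdom : ∀ v, c v ∈ S → ∃ x ∈ B, G.Adj x v := by
      intro v hv
      by_contra! hno
      exact hne ⟨v, hno, hv⟩
    refine ⟨S, subset_rfl, hS, ?_, .inr ⟨B, h, hBS, hdom, add_comm _ _⟩⟩
    rintro ⟨v, hv, hv'⟩
    exact (hne ⟨v, hv', hv⟩).elim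
  obtain ⟨w, L, hw, hcw, hLne, hwL, hLtr, hLI, hb1⟩ := hb.step hne
  have hS1 : S ∪ L.image c ⊆ I := Finset.union_subset hS (hLI.trans Finset.sdiff_subset)
  have hdisj : Disjoint S (L.image c) := by
    rw [Finset.disjoint_right]
    intro p hp
    exact (Finset.mem_sdiff.1 (hLI hp)).2
  have hcard : (S ∪ L.image c).card = S.card + L.card := by
    rw [Finset.card_union_of_disjoint hdisj, hLtr.card]
  have hpos := hLne.card_pos
  have e1 := Finset.card_sdiff_add_card_eq_card hS
  have e2 := Finset.card_sdiff_add_card_eq_card hS1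
  by_cases hL1 : L.card = 1
  · obtain ⟨t, rfl⟩ := Finset.card_eq_one.1 hL1
    have htS : c t ∉ S := fun hh =>
      Finset.disjoint_left.1 hdisj hh (Finset.mem_image_of_mem c (Finset.mem_singleton_self t))
    have hwt : G.Adj w t := hwL t (Finset.mem_singleton_self t)
    have htA : t ∈ {v | ∀ b ∈ B, ¬ G.Adj b v} := hLtr.mem t (Finset.mem_singleton_self t)
    have htB : c t ∉ B.image c := by
      intro hh
      obtain ⟨b, hb', hbt⟩ := Finset.mem_image.1 hh
      exact htS (hbt ▸ hBS b hb')
    have h' := h.insert_leaf hwt hw htA htB (fun he => htS (he ▸ hcw))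
    have hset : {v ∈ {v | ∀ b ∈ B, ¬ G.Adj b v} | ¬ G.Adj w v ∧ ∀ t' ∈ ({t} : Finset V),
        ¬ G.Adj t' v} = {v | ∀ b ∈ insert w (insert t B), ¬ G.Adj b v} := by
      ext v
      simp only [Set.mem_ofPred_eq, Finset.mem_insert, Finset.mem_singleton, forall_eq_or_imp,
        forall_eq]
      tauto
    rw [hset] at hb1
    have hc' : (insert w (insert t B)).card = B.card + 2 := by
      have h1 : t ∉ B := fun hh => htB (Finset.mem_image_of_mem c hh)
      have h2 : w ∉ insert t B := by
        rw [Finset.mem_insert]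
        rintro (rfl | hh)
        · exact G.irrefl hwt
        · obtain ⟨b, hb', hwb⟩ := h.mate w hh
          exact hw b hb' hwb.symm
      rw [Finset.card_insert_of_notMem h2, Finset.card_insert_of_notMem h1]
    obtain ⟨S', h1, h2, -, h3⟩ := ih _ (by omega) h' (by
      intro b hb'
      rw [Finset.mem_insert, Finset.mem_insert] at hb'
      rw [Finset.mem_union]
      rcases hb' with rfl | rfl | hb'
      exacts [.inl hcw, .inr (by simp), .inl (hBS b hb')]) hS1 hb1 rfl
    refine ⟨S', Finset.subset_union_left.trans h1, h2, fun _ => ?_, ?_⟩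
    · rintro rfl
      exact htS (h1 (by simp))
    · rw [hcard, hc', hL1] at h3
      rcases h3 with ⟨X, hX, hXc⟩ | ⟨B', k1, k2, k3, k4⟩
      · exact .inl ⟨X, hX, by omega⟩
      · exact .inr ⟨B', k1, k2, k3, by omega⟩
  -- A star with at least two leaves costs `1 + |L| ≤ 2 * |L| - 1` vertices, one below the budget of
  -- two per new colour.
  · obtain ⟨S', X, h1, h2, h3, h4⟩ := hb1.exists_dominating hS1
    have h1c := Finset.card_le_card h1
    refine ⟨S', Finset.subset_union_left.trans h1, h2, fun _ => ?_,
      .inl ⟨B ∪ insert w (L ∪ X), ?_, ?_⟩⟩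
    · rintro rfl
      omega
    · intro v hcv
      by_cases hvB : ∃ b ∈ B, G.Adj b v
      · obtain ⟨b, hb', hbv⟩ := hvB
        exact ⟨b, by simp [hb'], hbv⟩
      by_cases hvw : G.Adj w v
      · exact ⟨w, by simp, hvw⟩
      by_cases hvL : ∃ t ∈ L, G.Adj t v
      · obtain ⟨t, ht, htv⟩ := hvL
        exact ⟨t, by simp [ht], htv⟩
      · push Not at hvL hvB
        obtain ⟨x, hx, hxv⟩ := h3 v ⟨hvB, hvw, hvL⟩ hcv
        exact ⟨x, by simp [hx], hxv⟩
    · have := Finset.card_insert_le w (L ∪ X)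
      have := Finset.card_union_le L X
      have := Finset.card_union_le B (insert w (L ∪ X))
      omega

/-- There are many pairwise unlinked colours. -/
lemma exists_unlinked (h : IsForestMatching G c B) (S : Finset ι) :
    ∃ R ⊆ S, (∀ p ∈ R, ∀ q ∈ R, Linked G c B p q → p = q) ∧ 2 * S.card ≤ 2 * R.card + B.card := by
  induction hm : B.card using Nat.strong_induction_on generalizing B with
  | _ m ih =>
  subst hm
  rcases B.eq_empty_or_nonempty with rfl | ⟨x, hx⟩
  · exact ⟨S, subset_rfl, fun p _ q _ hl => hl.eq_of_notMem (by simp), by simp⟩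
  obtain ⟨y, hy, hxy⟩ := h.mate x hx
  have hcard := card_erase hx hy hxy
  obtain ⟨R, hRS, hR, hRc⟩ := ih _ (by omega) (h.erase hx hy hxy) rfl
  have hcut : ∀ p q, Linked G c B p q → _ := fun p q hl =>
    hl.cases_edge (h.pair_cases hx hy hxy)
  -- Restoring `xy` merges at most two trees, so it suffices to drop the representative of the tree
  -- at `c x`, if there is one.
  by_cases h1 : ∃ ρ ∈ R, Linked G c (B \ {x, y}) ρ (c x)
  · obtain ⟨ρ, hρ, hρx⟩ := h1
    have hne : ∀ p ∈ R.erase ρ, ¬ Linked G c (B \ {x, y}) p (c x) := fun p hp hl =>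
      Finset.ne_of_mem_erase hp (hR p (Finset.mem_of_mem_erase hp) ρ hρ (hl.trans hρx.symm))
    refine ⟨R.erase ρ, (Finset.erase_subset _ _).trans hRS, fun p hp q hq hl => ?_, ?_⟩
    · rcases hcut p q hl with hl | ⟨hl, -⟩ | ⟨-, hl⟩
      · exact hR p (Finset.mem_of_mem_erase hp) q (Finset.mem_of_mem_erase hq) hl
      · exact (hne p hp hl).elim
      · exact (hne q hq hl.symm).elim
    · have := Finset.card_erase_add_one hρ
      omega
  · push Not at h1
    refine ⟨R, hRS, fun p hp q hq hl => ?_, by omega⟩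
    rcases hcut p q hl with hl | ⟨hl, -⟩ | ⟨-, hl⟩
    · exact hR p hp q hq hl
    · exact (h1 p hp hl).elim
    · exact (h1 q hq hl.symm).elim

/-- The part of a forest matching inside a union of components has fewer edges than colours. -/
lemma card_filter_le (h : IsForestMatching G c B) {C : Finset ι} {ρ : ι} (hρ : ρ ∈ C)
    (hC : ∀ u ∈ B, ∀ v ∈ B, G.Adj u v → c u ∈ C → c v ∈ C) :
    (B.filter fun b => c b ∈ C).card + 2 ≤ 2 * C.card := by
  have hsub : (B.filter fun b => c b ∈ C) ⊆ B := Finset.filter_subset _ _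
  have h' : IsForestMatching G c (B.filter fun b => c b ∈ C) := by
    refine ⟨fun u hu => ?_, fun u hu v hv w hw => h.unique u (hsub hu) v (hsub hv) w (hsub hw),
      fun u hu v hv ha hl => h.bridge u (hsub hu) v (hsub hv) ha
        (hl.mono (Finset.sdiff_subset_sdiff hsub subset_rfl))⟩
    rw [Finset.mem_filter] at hu
    obtain ⟨v, hv, ha⟩ := h.mate u hu.1
    exact ⟨v, Finset.mem_filter.2 ⟨hv, hC u hu.1 v hv ha hu.2⟩, ha⟩
  -- One end per edge, with distinct colours in `C` other than `ρ`, bounds the number of edges by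
  -- `|C| - 1`.
  obtain ⟨T, hT, -, hinj, hav, hTc⟩ := h'.exists_selection {ρ} (by
    rintro p rfl q rfl -; rfl)
  have himg : T.image c ⊆ C.erase ρ := by
    intro p hp
    obtain ⟨t, ht, rfl⟩ := Finset.mem_image.1 hp
    exact Finset.mem_erase.2 ⟨hav t ht, (Finset.mem_filter.1 (hT ht)).2⟩
  have h1 := Finset.card_le_card himg
  rw [Finset.card_image_of_injOn hinj] at h1
  have := Finset.card_erase_add_one hρ
  omega

end IsForestMatching

/-- A forest matching on the colour set `S` with `m` components that dominates all vertices with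
colours in `S`. -/
structure IsDominatingForest (G : SimpleGraph V) (c : V → ι) (m : ℕ) (S : Finset ι)
    (B : Finset V) : Prop where
  forest : IsForestMatching G c B
  color : ∀ b ∈ B, c b ∈ S
  card : B.card + 2 * m = 2 * S.card
  dom : ∀ v, c v ∈ S → ∃ b ∈ B, G.Adj b v

variable [Fintype V] [Fintype ι] [DecidableRel G.Adj] {Δ m : ℕ}

-- An unblocked `v` could be joined to `T` and to one end of each matching edge, chosen to avoid the
-- colour of `v`. This gives `(|S| - m) + 1 + (|ι| - |S|)` colours, one more than `hno` allows.
omit [Fintype V] in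
lemma IsForestMatching.blocked (h : IsForestMatching G c B) (hBS : ∀ b ∈ B, c b ∈ S)
    (hc : B.card + 2 * m = 2 * S.card)
    (hno : ∀ J T, IsTransversal G c Set.univ J T → J.card + m ≤ Fintype.card ι)
    (hT : ∃ T, IsTransversal G c {v | ∀ b ∈ B, ¬ G.Adj b v} (Finset.univ \ S) T) :
    Blocked G c {v | ∀ b ∈ B, ¬ G.Adj b v} Finset.univ S := by
  refine ⟨hT, fun T hT v hv hcv => ?_⟩
  by_contra! hvT
  obtain ⟨U, hU, hUi, hUinj, hUav, hUc⟩ := h.exists_selection {c v} (by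
    rintro p rfl q rfl -; rfl)
  have hUtr : IsTransversal G c Set.univ (U.image c) U := ⟨by simp, hUi, hUinj, rfl⟩
  have h1 : IsTransversal G c Set.univ (U.image c ∪ {c v}) (U ∪ {v}) := by
    refine hUtr.union (IsTransversal.singleton (Set.mem_univ v)) ?_ ?_
    · rw [Finset.disjoint_singleton_right]
      intro hh
      obtain ⟨u, hu, huv⟩ := Finset.mem_image.1 hh
      exact hUav u hu huv
    · intro s hs t ht
      rw [Finset.mem_singleton.1 ht]
      exact hv s (hU hs)
  have hsub : U.image c ∪ {c v} ⊆ S := by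
    refine Finset.union_subset ?_ (Finset.singleton_subset_iff.2 hcv)
    intro p hp
    obtain ⟨t, ht, rfl⟩ := Finset.mem_image.1 hp
    exact hBS t (hU ht)
  have hd : Disjoint (U.image c ∪ {c v}) (Finset.univ \ S) :=
    Finset.disjoint_sdiff.mono_left hsub
  have h2 := h1.union (hT.mono (Set.subset_univ _)) hd (by
    intro s hs t ht ha
    rcases Finset.mem_union.1 hs with h' | h'
    · exact hT.mem t ht s (hU h') ha
    · rw [Finset.mem_singleton.1 h'] at ha
      exact hvT t ht ha)
  have h3 := hno _ _ h2
  rw [Finset.card_union_of_disjoint hd, Finset.card_union_of_disjoint (by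
    rw [Finset.disjoint_singleton_right]
    intro hh
    obtain ⟨u, hu, huv⟩ := Finset.mem_image.1 hh
    exact hUav u hu huv), hUtr.card.symm, Finset.card_singleton] at h3
  have := Finset.card_sdiff_add_card_eq_card (Finset.subset_univ S)
  rw [Finset.card_univ] at this
  omega

namespace IsDominatingForest

variable (hdeg : ∀ v, G.degree v ≤ Δ)
  (hK : ∀ D : Finset ι, D.Nonempty → 4 * Δ * D.card <
    2 * (Finset.univ.filter fun v => c v ∈ D).card + 4 * Δ * m + Δ)
include hdeg hK

/-- The colours outside `S` have a full transversal that avoids all neighbours of the matching and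
of one further vertex. -/
lemma exists_outer (h : IsDominatingForest G c m S B) (z : V) :
    ∃ T, IsTransversal G c {v | (∀ b ∈ B, ¬ G.Adj b v) ∧ ¬ G.Adj z v} (Finset.univ \ S) T := by
  have := exists_transversal (c := c) hdeg
    (Finset.univ.filter fun v => (∀ b ∈ B, ¬ G.Adj b v) ∧ ¬ G.Adj z v) (Finset.univ \ S) (by
    -- The size condition is applied to `D ∪ S`. The vertices lost, including all those with colours
    -- in `S`, are dominated by `B` and `z`, hence number at most `Δ * (2 * |S| - 2 * m + 1)`.
    intro D hD hDne
    have hdisj : Disjoint D S := Finset.sdiff_disjoint.mono_left hD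
    have hk := hK (D ∪ S) (hDne.mono Finset.subset_union_left)
    rw [Finset.card_union_of_disjoint hdisj] at hk
    set U := Finset.univ.filter fun v => c v ∈ D ∪ S with hU
    set W := (Finset.univ.filter fun v => (∀ b ∈ B, ¬ G.Adj b v) ∧ ¬ G.Adj z v).filter
      fun v => c v ∈ D with hW
    have h1 : (U \ W).card ≤ Δ * (insert z B).card := by
      refine card_le_of_dominated hdeg fun u hu => ?_
      simp only [hU, hW, Finset.mem_sdiff, Finset.mem_filter, Finset.mem_univ, true_and,
        Finset.mem_union] at hu
      by_contra! hno
      rcases hu.1 with h' | h'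
      · exact hu.2 ⟨⟨fun b hb => hno b (Finset.mem_insert_of_mem hb),
          hno z (Finset.mem_insert_self _ _)⟩, h'⟩
      · obtain ⟨b, hb, hbu⟩ := h.dom u h'
        exact hno b (Finset.mem_insert_of_mem hb) hbu
    have h2 : U.card ≤ (U \ W).card + W.card := by
      have := Finset.le_card_sdiff W U
      omega
    have h3 := Finset.card_insert_le z B
    have h4 := Nat.mul_le_mul_left Δ h3
    have h5 : Δ * (B.card + 2 * m) = Δ * (2 * S.card) := by rw [h.card]
    nlinarith)
  simpa using this

/-- A vertex whose only neighbour in the matching is `x` lies on the side of the mate of `x`. -/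
lemma linked_mate (h : IsDominatingForest G c m S B)
    (hno : ∀ J T, IsTransversal G c Set.univ J T → J.card + m ≤ Fintype.card ι)
    (hx : x ∈ B) (hy : y ∈ B) (hxy : G.Adj x y) (hcz : c z ∈ S)
    (hz : ∀ b ∈ B, G.Adj b z → b = x) : Linked G c (B \ {x, y}) (c z) (c y) := by
  by_contra hl
  have hsubB : B \ {x, y} ⊆ B := Finset.sdiff_subset
  -- Otherwise both `y` and `z` can be added to a selection from the other edges, so the edge `xy`
  -- yields two colours. Together with the outer transversal `U`, only `m - 1` colours are missed.
  obtain ⟨T, hT, hTi, hTinj, hTav, hTc⟩ := (h.forest.erase hx hy hxy).exists_selection {c y, c z}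
    (by
      rintro p (rfl | rfl) q (rfl | rfl) hpq
      exacts [rfl, (hl hpq.symm).elim, (hl hpq).elim, rfl])
  obtain ⟨U, hU⟩ := h.exists_outer hdeg hK z
  have hcard := IsForestMatching.card_erase hx hy hxy
  have hTtr : IsTransversal G c Set.univ (T.image c) T := ⟨by simp, hTi, hTinj, rfl⟩
  have hyT : c y ∉ T.image c := by
    intro hh
    obtain ⟨u, hu, huv⟩ := Finset.mem_image.1 hh
    exact hTav u hu (.inl huv)
  have hzT : c z ∉ T.image c := by
    intro hh
    obtain ⟨u, hu, huv⟩ := Finset.mem_image.1 hh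
    exact hTav u hu (.inr huv)
  have hzy : c z ≠ c y := fun he => hl (he ▸ Linked.refl)
  have hd1 : Disjoint (T.image c) {c y} := by rwa [Finset.disjoint_singleton_right]
  have hd2 : Disjoint (T.image c ∪ {c y}) {c z} := by
    rw [Finset.disjoint_singleton_right, Finset.mem_union, Finset.mem_singleton]
    tauto
  have h1 : IsTransversal G c Set.univ (T.image c ∪ {c y}) (T ∪ {y}) := by
    refine hTtr.union (IsTransversal.singleton (Set.mem_univ y)) hd1 ?_
    intro s hs t ht ha
    rw [Finset.mem_singleton.1 ht] at ha
    have := h.forest.unique y hy s (hsubB (hT hs)) x hx ha.symm hxy.symm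
    subst this
    have := hT hs
    simp at this
  have h2 : IsTransversal G c Set.univ (T.image c ∪ {c y} ∪ {c z}) (T ∪ {y} ∪ {z}) := by
    refine h1.union (IsTransversal.singleton (Set.mem_univ z)) hd2 ?_
    intro s hs t ht ha
    rw [Finset.mem_singleton.1 ht] at ha
    rcases Finset.mem_union.1 hs with h' | h'
    · have := hz s (hsubB (hT h')) ha
      subst this
      have := hT h'
      simp at this
    · rw [Finset.mem_singleton.1 h'] at ha
      exact hxy.ne (hz y hy ha).symm
  have hsub : T.image c ∪ {c y} ∪ {c z} ⊆ S := by
    intro p hp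
    simp only [Finset.mem_union, Finset.mem_singleton, Finset.mem_image] at hp
    rcases hp with (⟨t, ht, rfl⟩ | rfl) | rfl
    exacts [h.color t (hsubB (hT ht)), h.color _ hy, hcz]
  have hd3 : Disjoint (T.image c ∪ {c y} ∪ {c z}) (Finset.univ \ S) :=
    Finset.disjoint_sdiff.mono_left hsub
  have h3 := h2.union (hU.mono (Set.subset_univ _)) hd3 (by
    intro s hs t ht ha
    obtain ⟨ht1, ht2⟩ := hU.mem t ht
    simp only [Finset.mem_union, Finset.mem_singleton] at hs
    rcases hs with (hs | rfl) | rfl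
    exacts [ht1 s (hsubB (hT hs)) ha, ht1 _ hy ha, ht2 ha])
  have h4 := hno _ _ h3
  rw [Finset.card_union_of_disjoint hd3, Finset.card_union_of_disjoint hd2,
    Finset.card_union_of_disjoint hd1, hTtr.card.symm, Finset.card_singleton,
    Finset.card_singleton] at h4
  have := Finset.card_sdiff_add_card_eq_card (Finset.subset_univ S)
  rw [Finset.card_univ] at this
  have := h.card
  omega

omit [Fintype ι] in
/-- More than `Δ / 2` vertices have `x` as their only neighbour in the matching. -/
lemma lt_card_private (h : IsDominatingForest G c m S B) (hx : x ∈ B) :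
    Δ < 2 * (Finset.univ.filter fun z => c z ∈ S ∧ G.Adj x z ∧
      ∀ b ∈ B, G.Adj b z → b = x).card := by
  have hk := hK S ⟨c x, h.color x hx⟩
  set U := Finset.univ.filter fun v => c v ∈ S with hU
  set E := Finset.univ.filter fun z => c z ∈ S ∧ G.Adj x z ∧ ∀ b ∈ B, G.Adj b z → b = x with hE
  -- Every vertex outside `E` has a neighbour in `B` other than `x`; the size condition leaves more
  -- than `Δ / 2` vertices undominated by `B.erase x`.
  have h1 : (U \ E).card ≤ Δ * (B.erase x).card := by
    refine card_le_of_dominated hdeg fun u hu => ?_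
    simp only [hU, hE, Finset.mem_sdiff, Finset.mem_filter, Finset.mem_univ, true_and] at hu
    by_contra! hno
    have hall : ∀ b ∈ B, G.Adj b u → b = x := fun b hb hbu => by
      by_contra hbx
      exact hno b (Finset.mem_erase.2 ⟨hbx, hb⟩) hbu
    obtain ⟨b, hb, hbu⟩ := h.dom u hu.1
    exact hu.2 ⟨hu.1, hall b hb hbu ▸ hbu, hall⟩
  have h2 : U.card ≤ (U \ E).card + E.card := by
    have := Finset.le_card_sdiff E U
    omega
  have h3 := Finset.card_erase_add_one hx
  have h5 : Δ * (B.card + 2 * m) = Δ * (2 * S.card) := by rw [h.card]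
  rw [← h3] at h5
  nlinarith

end IsDominatingForest

end Extremal

/-! ### The partial transversal theorem. -/

section Partial

variable {V ι : Type*} [DecidableEq V] [DecidableEq ι] [Fintype V] [Fintype ι]
variable {G : SimpleGraph V} [DecidableRel G.Adj] {c : V → ι} {Δ m q : ℕ}

omit [Fintype ι] in
/-- Unless few vertices dominate many colours, which the size condition excludes, a forest matching with `m`
components inside a blocked configuration grows to a dominating one. -/
lemma IsForestMatching.exists_dominatingForest (hdeg : ∀ v, G.degree v ≤ Δ)
    (hK : ∀ D : Finset ι, D.Nonempty → 4 * Δ * D.card <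
      2 * (Finset.univ.filter fun v => c v ∈ D).card + 4 * Δ * m + Δ)
    {B : Finset V} {S I : Finset ι} (h : IsForestMatching G c B) (hBS : ∀ b ∈ B, c b ∈ S)
    (hc : B.card + 2 * m = 2 * S.card) (hS : S ⊆ I)
    (hb : Blocked G c {v | ∀ b ∈ B, ¬ G.Adj b v} I S) :
    ∃ S' B', S ⊆ S' ∧ ((∃ v, c v ∈ S ∧ ∀ b ∈ B, ¬ G.Adj b v) → S ≠ S') ∧
      IsDominatingForest G c m S' B' := by
  obtain ⟨S', h1, h2, h3, ⟨X, hX, hXc⟩ | ⟨B', k1, k2, k3, k4⟩⟩ := h.grow hBS hS hb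
  · exfalso
    have hne : S'.Nonempty := Finset.card_pos.1 (by omega)
    have hk := hK S' hne
    have hle := card_le_of_dominated hdeg (U := Finset.univ.filter fun v => c v ∈ S') (X := X) (by
      intro u hu
      exact hX u (Finset.mem_filter.1 hu).2)
    have : Δ * (X.card + 1 + 2 * m) ≤ Δ * (2 * S'.card) := Nat.mul_le_mul_left _ (by omega)
    nlinarith
  · exact ⟨S', B', h1, h3, k1, k2, by omega, k3⟩

/-- A multipartite graph whose colour classes are large compared to its maximum degree has a rainbow
independent set that misses fewer than `m` colours. -/
theorem exists_partial_transversal (hdeg : ∀ v, G.degree v ≤ Δ)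
    (hmι : m ≤ Fintype.card ι) (hι : Fintype.card ι < (q + 1) * m)
    (hK : ∀ D : Finset ι, D.Nonempty → 4 * Δ * D.card <
      2 * (Finset.univ.filter fun v => c v ∈ D).card + 4 * Δ * m + Δ)
    (hsmall : ∀ D : Finset ι, D.Nonempty → D.card ≤ q → 2 * Δ * D.card <
      (Finset.univ.filter fun v => c v ∈ D).card + 2 * Δ) :
    ∃ J T, IsTransversal G c Set.univ J T ∧ Fintype.card ι < J.card + m := by
  classical
  by_contra! hno
  have hne : ∃ S B, IsDominatingForest G c m S B := by
    obtain ⟨I, S, hSI, -, hSm, hb⟩ := exists_blocked G c Set.univ Finset.univ m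
      (by rwa [Finset.card_univ]) (fun J _ T hT => by
        rw [Finset.card_univ]
        exact hno J T hT)
    have h0 : IsForestMatching G c ∅ := ⟨by simp, by simp, by simp⟩
    obtain ⟨S', B', -, -, h⟩ := h0.exists_dominatingForest hdeg hK (S := S) (by simp)
      (by simp [hSm]) hSI (by simpa using hb)
    exact ⟨S', B', h⟩
  -- Maximality of `S` is what makes domination survive a switch.
  obtain ⟨S, hS, hmax⟩ := Finset.exists_max_image
    (Finset.univ.filter fun S => ∃ B, IsDominatingForest G c m S B) Finset.card
    (by obtain ⟨S, hS⟩ := hne; exact ⟨S, by simpa using hS⟩)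
  rw [Finset.mem_filter] at hS
  obtain ⟨-, B, hB⟩ := hS
  have hswitch : ∀ B', IsDominatingForest G c m S B' → ∀ x ∈ B', ∀ y ∈ B', G.Adj x y → ∀ z,
      c z ∈ S → G.Adj x z → (∀ b ∈ B', G.Adj b z → b = x) →
      IsDominatingForest G c m S (insert z (B'.erase y)) := by
    intro B' hB' x hx y hy hxy z hcz hxz hz
    have hl := hB'.linked_mate hdeg hK hno hx hy hxy hcz hz
    have hF := hB'.forest.switch hx hy hxy hxz hz hl
    have hcol : ∀ b ∈ insert z (B'.erase y), c b ∈ S := by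
      intro b hb
      rcases Finset.mem_insert.1 hb with rfl | hb
      exacts [hcz, hB'.color b (Finset.mem_of_mem_erase hb)]
    have hcard : (insert z (B'.erase y)).card + 2 * m = 2 * S.card := by
      rw [Finset.card_insert_of_notMem, Finset.card_erase_add_one hy, hB'.card]
      intro hzB
      rw [Finset.mem_erase] at hzB
      exact hzB.1 (hB'.forest.unique x hx z hzB.2 y hy hxz hxy)
    obtain ⟨U, hU⟩ := hB'.exists_outer hdeg hK z
    have hb := hF.blocked hcol hcard hno ⟨U, hU.mono (by
      rintro v ⟨hv1, hv2⟩ b hb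
      rcases Finset.mem_insert.1 hb with rfl | hb
      exacts [hv2, hv1 b (Finset.mem_of_mem_erase hb)])⟩
    refine ⟨hF, hcol, hcard, ?_⟩
    -- A switched matching leaving some vertex with a colour in `S` undominated would grow to a
    -- dominating forest on strictly more colours.
    by_contra! hund
    obtain ⟨S', B'', hSS', hneS, hB''⟩ :=
      hF.exists_dominatingForest hdeg hK hcol hcard (Finset.subset_univ S) hb
    have h1 := hmax S' (by simpa using ⟨B'', hB''⟩)
    have h2 := Finset.card_lt_card (hSS'.ssubset_of_ne (hneS hund))
    omega
  obtain ⟨R, hRS, hR, hRc⟩ := hB.forest.exists_unlinked S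
  have hRm : m ≤ R.card := by have := hB.card; omega
  -- The at least `m` trees have disjoint colour sets, and there are fewer than `(q + 1) * m`
  -- colours.
  obtain ⟨ρ, hρ, hρc⟩ : ∃ ρ ∈ R, (S.filter fun p => Linked G c B ρ p).card ≤ q := by
    by_contra! hbig
    have h1 : (R.biUnion fun ρ => S.filter fun p => Linked G c B ρ p).card ≤ S.card :=
      Finset.card_le_card (Finset.biUnion_subset.2 fun ρ _ => Finset.filter_subset _ _)
    rw [Finset.card_biUnion (by
      intro ρ hρ ρ' hρ' hne
      rw [Function.onFun, Finset.disjoint_left]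
      intro p hp hp'
      rw [Finset.mem_filter] at hp hp'
      exact hne (hR ρ hρ ρ' hρ' (hp.2.trans hp'.2.symm)))] at h1
    have h2 := Finset.card_nsmul_le_sum R (fun ρ => (S.filter fun p => Linked G c B ρ p).card)
      (q + 1) (fun ρ hρ => hbig ρ hρ)
    have h3 := Finset.card_le_univ S
    have h4 : (q + 1) * m ≤ (q + 1) * R.card := Nat.mul_le_mul_left _ hRm
    rw [smul_eq_mul, mul_comm] at h2
    omega
  set C := S.filter fun p => Linked G c B ρ p with hC
  have hCS : C ⊆ S := Finset.filter_subset _ _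
  have hρC : ρ ∈ C := Finset.mem_filter.2 ⟨hRS hρ, Linked.refl⟩
  have hclosed : ∀ u ∈ B, ∀ v ∈ B, G.Adj u v → c u ∈ C → c v ∈ C := by
    intro u hu v hv ha hcu
    rw [hC, Finset.mem_filter] at hcu ⊢
    exact ⟨hB.color v hv, hcu.2.trans (.of_adj hu hv ha)⟩
  have hcardC := hB.forest.card_filter_le hρC hclosed
  have hdomC : ∀ z, c z ∈ C → ∃ b ∈ B.filter (fun b => c b ∈ C), G.Adj b z := by
    intro z hz
    by_contra! hzB
    -- Among the dominating forests with no new vertex and no outgoing edge at `C`, one is taken in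
    -- which `z` has fewest neighbours. All these neighbours have colours outside `C`.
    obtain ⟨B', hB', hmin⟩ := Finset.exists_min_image
      (Finset.univ.filter fun B' => IsDominatingForest G c m S B' ∧
        (∀ b ∈ B', c b ∈ C → b ∈ B) ∧
        (∀ u ∈ B', ∀ v ∈ B', G.Adj u v → c u ∈ C → c v ∈ C))
      (fun B' => (B'.filter fun b => G.Adj b z).card)
      ⟨B, by simpa using ⟨hB, fun b hb _ => hb, hclosed⟩⟩
    rw [Finset.mem_filter] at hB'
    obtain ⟨-, hdf, hCB, hcl⟩ := hB'
    have hnot : ∀ b ∈ B', G.Adj b z → c b ∉ C := fun b hb hbz hbC =>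
      hzB b (Finset.mem_filter.2 ⟨hCB b hb hbC, hbC⟩) hbz
    -- If `y` is a neighbour of `z`, then `z` is adjacent to all private neighbours of the mate `x`:
    -- otherwise switching `y` to such a vertex removes a neighbour of `z`.
    have hkey : ∀ y ∈ B', G.Adj y z → ∀ x ∈ B', G.Adj x y → ∀ b, c b ∈ S → G.Adj x b →
        (∀ a ∈ B', G.Adj a b → a = x) → G.Adj b z := by
      intro y hy hyz x hx hxy b hcb hxb hb
      by_contra hbz
      have hyC := hnot y hy hyz
      have hxC : c x ∉ C := fun hxC => hyC (hcl x hx y hy hxy hxC)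
      have hsw := hswitch B' hdf x hx y hy hxy b hcb hxb hb
      have hl := hdf.linked_mate hdeg hK hno hx hy hxy hcb hb
      have hbC : c b ∉ C := fun hbC => hyC ((hl.mem_iff (C := C) fun u hu v hv ha => hcl u (Finset.sdiff_subset hu) v
        (Finset.sdiff_subset hv) ha).1 hbC)
      have hle := hmin (insert b (B'.erase y)) (by
        rw [Finset.mem_filter]
        refine ⟨Finset.mem_univ _, hsw, fun a ha haC => ?_, fun u hu v hv ha hcu => ?_⟩
        · rcases Finset.mem_insert.1 ha with rfl | ha
          exacts [(hbC haC).elim, hCB a (Finset.mem_of_mem_erase ha) haC]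
        · rcases Finset.mem_insert.1 hu with rfl | hu
          · exact (hbC hcu).elim
          · have hu' := Finset.mem_of_mem_erase hu
            rcases Finset.mem_insert.1 hv with rfl | hv
            · exact (hxC (hb u hu' ha ▸ hcu)).elim
            · exact hcl u hu' v (Finset.mem_of_mem_erase hv) ha hcu)
      have hsub : (insert b (B'.erase y)).filter (fun a => G.Adj a z) ⊆
          (B'.filter fun a => G.Adj a z).erase y := by
        intro a ha
        rw [Finset.mem_filter, Finset.mem_insert, Finset.mem_erase] at ha
        rcases ha with ⟨rfl | ha, haz⟩
        · exact (hbz haz).elim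
        · exact Finset.mem_erase.2 ⟨ha.1, Finset.mem_filter.2 ⟨ha.2, haz⟩⟩
      have h1 := Finset.card_le_card hsub
      have h2 := Finset.card_erase_lt_of_mem (Finset.mem_filter.2 ⟨hy, hyz⟩ :
        y ∈ B'.filter fun a => G.Adj a z)
      omega
    obtain ⟨y, hy, hyz⟩ := hdf.dom z (hCS hz)
    obtain ⟨x, hx, hyx⟩ := hdf.forest.mate y hy
    -- Two neighbours in `B'` would give `z` two disjoint sets of more than `Δ / 2` neighbours each.
    have honly : ∀ a ∈ B', G.Adj a z → a = y := by
      intro a ha haz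
      by_contra hay
      obtain ⟨x', hx', hax'⟩ := hdf.forest.mate a ha
      have hxx' : x ≠ x' := by
        rintro rfl
        exact hay (hdf.forest.unique x hx a ha y hy hax'.symm hyx.symm)
      have hE := hdf.lt_card_private hdeg hK hx
      have hE' := hdf.lt_card_private hdeg hK hx'
      set E := Finset.univ.filter fun v => c v ∈ S ∧ G.Adj x v ∧ ∀ b ∈ B', G.Adj b v → b = x
        with hEdef
      set E' := Finset.univ.filter fun v => c v ∈ S ∧ G.Adj x' v ∧ ∀ b ∈ B', G.Adj b v → b = x'
        with hEdef'
      have hdisj : Disjoint E E' := by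
        rw [Finset.disjoint_left]
        intro v hv hv'
        rw [hEdef, Finset.mem_filter] at hv
        rw [hEdef', Finset.mem_filter] at hv'
        exact hxx' (hv'.2.2.2 x hx hv.2.2.1)
      have hsub : E ∪ E' ⊆ G.neighborFinset z := by
        intro v hv
        rw [SimpleGraph.mem_neighborFinset]
        rcases Finset.mem_union.1 hv with hv | hv
        · rw [hEdef, Finset.mem_filter] at hv
          exact (hkey y hy hyz x hx hyx.symm v hv.2.1 hv.2.2.1 hv.2.2.2).symm
        · rw [hEdef', Finset.mem_filter] at hv
          exact (hkey a ha haz x' hx' hax'.symm v hv.2.1 hv.2.2.1 hv.2.2.2).symm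
      have h1 := Finset.card_le_card hsub
      rw [Finset.card_union_of_disjoint hdisj, G.card_neighborFinset_eq_degree] at h1
      have := hdeg z
      omega
    -- Now `z` is itself a private neighbour of `y`, so its colour is linked to that of `x`. But `C`
    -- is closed under links and contains only the former.
    have hl := hdf.linked_mate hdeg hK hno hy hx hyx (hCS hz) honly
    have hxC : c x ∉ C := fun hxC => hnot y hy hyz (hcl x hx y hy hyx.symm hxC)
    exact hxC ((hl.mem_iff (C := C) fun u hu v hv ha => hcl u (Finset.sdiff_subset hu) v
        (Finset.sdiff_subset hv) ha).1 hz)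
  have hle := card_le_of_dominated hdeg (U := Finset.univ.filter fun v => c v ∈ C)
    (X := B.filter fun b => c b ∈ C) (by
      intro u hu
      exact hdomC u (Finset.mem_filter.1 hu).2)
  have hs := hsmall C ⟨ρ, hρC⟩ hρc
  have := Nat.mul_le_mul_left Δ hcardC
  nlinarith

end Partial

/-! ### The extremal graph as a union of complete bipartite graphs. -/

section Construction

/-- Position of the `a`-th vertex of the `j`-th of `p` consecutive parts on the line which is cut
into segments of length `Δ`. -/
def slot (p n Δ j a : ℕ) : ℕ := j * (n - Δ) + if j + 1 < p then a - Δ else a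

/-- The complete bipartite graph, and the side of it, to which the `a`-th vertex of part `i`
belongs. The parts come in halves of `p` parts and copies of two halves; the parts from
`2 * p * (d + 1)` on consist of isolated vertices. -/
def bicliqueLabel (p d n Δ i a : ℕ) : (ℕ × ℕ) × Bool :=
  if 2 * p * (d + 1) ≤ i then ((d + 1, 0), false)
  else if i % p + 1 < p ∧ a < Δ then ((i / p, i % p + 1), true)
  else if slot p n Δ (i % p) a < Δ then ((i / p / 2, 0), decide (i / p % 2 = 1))
  else ((i / p, slot p n Δ (i % p) a / Δ), false)

/-- The union of complete bipartite graphs given by a labelling of the vertices. -/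
def bicliqueGraph {V K : Type*} (f : V → K × Bool) : SimpleGraph V where
  Adj u v := (f u).1 = (f v).1 ∧ (f u).2 ≠ (f v).2
  symm := ⟨fun _ _ h => ⟨h.1.symm, h.2.symm⟩⟩
  loopless := ⟨fun _ h => h.2 rfl⟩

variable {p d n Δ : ℕ}

/-- Each part before the last adds at most `n - Δ ≤ Δ` to the line, and the last one still fits by
`hn`. Hence part `j` reaches only segments up to `j`, which face the bicliques of earlier parts or
the root; its own biclique has index `j + 1`. -/
lemma slot_lt (hn : p * n ≤ Δ * (2 * p - 1)) {j a : ℕ} (hj : j < p) (ha : a < n)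
    (hA : ¬ (j + 1 < p ∧ a < Δ)) : slot p n Δ j a < (j + 1) * Δ := by
  obtain ⟨p, rfl⟩ : ∃ p', p = p' + 1 := ⟨p - 1, by omega⟩
  have hn' : (p + 1) * n ≤ Δ * (2 * p + 1) := by
    simpa [show 2 * (p + 1) - 1 = 2 * p + 1 by omega] using hn
  have h2 : n ≤ 2 * Δ := by nlinarith
  unfold slot
  split_ifs with h
  · have hΔ : Δ ≤ a := by
      by_contra hh
      exact hA ⟨h, by omega⟩
    have : j * (n - Δ) ≤ j * Δ := Nat.mul_le_mul_left _ (by omega)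
    have : (j + 1) * Δ = j * Δ + Δ := by ring
    omega
  · have hjp : j = p := by omega
    subst hjp
    rcases le_total n Δ with h3 | h3
    · rw [Nat.sub_eq_zero_of_le h3]
      nlinarith
    · obtain ⟨e, rfl⟩ := Nat.exists_eq_add_of_le h3
      rw [Nat.add_sub_cancel_left]
      nlinarith

lemma slot_lt_of_lt {j a j' a' : ℕ} (hj' : j' < p) (ha : a < n)
    (hA : ¬ (j + 1 < p ∧ a < Δ)) (hlt : j < j') : slot p n Δ j a < slot p n Δ j' a' := by
  have hj : j + 1 < p := by omega
  have hΔ : Δ ≤ a := by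
    by_contra hh
    exact hA ⟨hj, by omega⟩
  have h1 : (j + 1) * (n - Δ) ≤ j' * (n - Δ) := Nat.mul_le_mul_right _ hlt
  have h2 : (j + 1) * (n - Δ) = j * (n - Δ) + (n - Δ) := by ring
  unfold slot
  rw [if_pos hj]
  omega

lemma slot_inj {j a j' a' : ℕ} (hj : j < p) (hj' : j' < p) (ha : a < n) (ha' : a' < n)
    (hA : ¬ (j + 1 < p ∧ a < Δ)) (hA' : ¬ (j' + 1 < p ∧ a' < Δ))
    (h : slot p n Δ j a = slot p n Δ j' a') : j = j' ∧ a = a' := by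
  rcases lt_trichotomy j j' with hlt | rfl | hlt
  · exact absurd h (slot_lt_of_lt hj' ha hA hlt).ne
  · refine ⟨rfl, ?_⟩
    unfold slot at h
    split_ifs at h with hh
    · have : ¬ a < Δ := fun h' => hA ⟨hh, h'⟩
      have : ¬ a' < Δ := fun h' => hA' ⟨hh, h'⟩
      omega
    · omega
  · exact absurd h (slot_lt_of_lt hj ha' hA' hlt).ne'

lemma eq_of_div_eq_of_mod_eq {i i' : ℕ} (h : i / p = i' / p) (h' : i % p = i' % p) : i = i' := by
  rw [← Nat.div_add_mod i p, ← Nat.div_add_mod i' p, h, h']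

section Labels

variable {i a : ℕ}

lemma bicliqueLabel_of_le (h : 2 * p * (d + 1) ≤ i) :
    bicliqueLabel p d n Δ i a = ((d + 1, 0), false) := if_pos h

lemma bicliqueLabel_own (h : i < 2 * p * (d + 1)) (hA : i % p + 1 < p ∧ a < Δ) :
    bicliqueLabel p d n Δ i a = ((i / p, i % p + 1), true) := by
  rw [bicliqueLabel, if_neg h.not_ge, if_pos hA]

lemma bicliqueLabel_root (h : i < 2 * p * (d + 1)) (hA : ¬ (i % p + 1 < p ∧ a < Δ))
    (hs : slot p n Δ (i % p) a < Δ) :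
    bicliqueLabel p d n Δ i a = ((i / p / 2, 0), decide (i / p % 2 = 1)) := by
  rw [bicliqueLabel, if_neg h.not_ge, if_neg hA, if_pos hs]

lemma bicliqueLabel_slot (h : i < 2 * p * (d + 1)) (hA : ¬ (i % p + 1 < p ∧ a < Δ))
    (hs : Δ ≤ slot p n Δ (i % p) a) :
    bicliqueLabel p d n Δ i a = ((i / p, slot p n Δ (i % p) a / Δ), false) := by
  rw [bicliqueLabel, if_neg h.not_ge, if_neg hA, if_neg hs.not_gt]

end Labels

/-- A position in `[0, Δ)` which together with the label determines the vertex. -/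
def bicliqueIndex (p n Δ i a : ℕ) : ℕ :=
  if i % p + 1 < p ∧ a < Δ then a else slot p n Δ (i % p) a % Δ

lemma bicliqueIndex_lt (hΔ : 0 < Δ) (i a : ℕ) : bicliqueIndex p n Δ i a < Δ := by
  unfold bicliqueIndex
  split_ifs with h
  exacts [h.2, Nat.mod_lt _ hΔ]

/-- This bounds each side of a biclique by `Δ` vertices, and with it the degrees. -/
lemma bicliqueIndex_inj (hp : 0 < p) (hΔ : 0 < Δ) {i a i' a' : ℕ} (ha : a < n) (ha' : a' < n)
    (hi : i < 2 * p * (d + 1)) (hi' : i' < 2 * p * (d + 1))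
    (hl : bicliqueLabel p d n Δ i a = bicliqueLabel p d n Δ i' a')
    (hx : bicliqueIndex p n Δ i a = bicliqueIndex p n Δ i' a') : i = i' ∧ a = a' := by
  have hj := Nat.mod_lt i hp
  have hj' := Nat.mod_lt i' hp
  unfold bicliqueIndex at hx
  by_cases hA : i % p + 1 < p ∧ a < Δ <;> by_cases hA' : i' % p + 1 < p ∧ a' < Δ
  · rw [if_pos hA, if_pos hA'] at hx
    rw [bicliqueLabel_own hi hA, bicliqueLabel_own hi' hA'] at hl
    simp only [Prod.mk.injEq, Nat.add_right_cancel_iff, and_true] at hl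
    exact ⟨eq_of_div_eq_of_mod_eq hl.1 hl.2, hx⟩
  · rw [bicliqueLabel_own hi hA] at hl
    rcases lt_or_ge (slot p n Δ (i' % p) a') Δ with hs' | hs'
    · rw [bicliqueLabel_root hi' hA' hs'] at hl; simp at hl
    · rw [bicliqueLabel_slot hi' hA' hs'] at hl; simp at hl
  · rw [bicliqueLabel_own hi' hA'] at hl
    rcases lt_or_ge (slot p n Δ (i % p) a) Δ with hs | hs
    · rw [bicliqueLabel_root hi hA hs] at hl; simp at hl
    · rw [bicliqueLabel_slot hi hA hs] at hl; simp at hl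
  · rw [if_neg hA, if_neg hA'] at hx
    have key : i / p = i' / p → slot p n Δ (i % p) a = slot p n Δ (i' % p) a' →
        i = i' ∧ a = a' := by
      intro h1 h2
      obtain ⟨h3, h4⟩ := slot_inj hj hj' ha ha' hA hA' h2
      exact ⟨eq_of_div_eq_of_mod_eq h1 h3, h4⟩
    rcases lt_or_ge (slot p n Δ (i % p) a) Δ with hs | hs <;>
      rcases lt_or_ge (slot p n Δ (i' % p) a') Δ with hs' | hs'
    · rw [bicliqueLabel_root hi hA hs, bicliqueLabel_root hi' hA' hs'] at hl
      rw [Nat.mod_eq_of_lt hs, Nat.mod_eq_of_lt hs'] at hx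
      simp only [Prod.mk.injEq, and_true, decide_eq_decide] at hl
      exact key (by omega) hx
    · rw [bicliqueLabel_root hi hA hs, bicliqueLabel_slot hi' hA' hs'] at hl
      simp only [Prod.mk.injEq] at hl
      have := Nat.div_pos hs' hΔ
      omega
    · rw [bicliqueLabel_slot hi hA hs, bicliqueLabel_root hi' hA' hs'] at hl
      simp only [Prod.mk.injEq] at hl
      have := Nat.div_pos hs hΔ
      omega
    · rw [bicliqueLabel_slot hi hA hs, bicliqueLabel_slot hi' hA' hs'] at hl
      simp only [Prod.mk.injEq, and_true] at hl
      exact key hl.1 (eq_of_div_eq_of_mod_eq hl.2 hx)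

/-- The key `(d + 1, 0)` is reserved for the surplus parts: root keys stop at `(d, 0)`, and all
other keys have a positive second entry. -/
lemma le_of_bicliqueLabel_eq (hp : 0 < p) (hΔ : 0 < Δ) {i a : ℕ}
    (h : (bicliqueLabel p d n Δ i a).1 = (d + 1, 0)) : 2 * p * (d + 1) ≤ i := by
  by_contra! hi
  have hlt : i / p < 2 * (d + 1) := by
    rw [Nat.div_lt_iff_lt_mul hp]
    linarith
  by_cases hA : i % p + 1 < p ∧ a < Δ
  · rw [bicliqueLabel_own hi hA] at h; simp at h
  rcases lt_or_ge (slot p n Δ (i % p) a) Δ with hs | hs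
  · rw [bicliqueLabel_root hi hA hs] at h
    simp only [Prod.mk.injEq, and_true] at h
    omega
  · rw [bicliqueLabel_slot hi hA hs] at h
    simp only [Prod.mk.injEq] at h
    have := Nat.div_pos hs hΔ
    omega

/-- The two sides of a biclique do not meet the same part. -/
lemma bicliqueLabel_side (hp : 0 < p) (hn : p * n ≤ Δ * (2 * p - 1)) {i a a' : ℕ}
    (ha : a < n) (ha' : a' < n)
    (h : (bicliqueLabel p d n Δ i a).1 = (bicliqueLabel p d n Δ i a').1) :
    (bicliqueLabel p d n Δ i a).2 = (bicliqueLabel p d n Δ i a').2 := by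
  rcases le_or_gt (2 * p * (d + 1)) i with hi | hi
  · rw [bicliqueLabel_of_le hi, bicliqueLabel_of_le hi]
  have hj := Nat.mod_lt i hp
  have key : ∀ a a', a' < n → i % p + 1 < p ∧ a < Δ → ¬ (i % p + 1 < p ∧ a' < Δ) →
      (bicliqueLabel p d n Δ i a).1 ≠ (bicliqueLabel p d n Δ i a').1 := by
    intro a a' ha' hA hA' h
    rw [bicliqueLabel_own hi hA] at h
    rcases lt_or_ge (slot p n Δ (i % p) a') Δ with hs' | hs'
    · rw [bicliqueLabel_root hi hA' hs'] at h; simp at h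
    · rw [bicliqueLabel_slot hi hA' hs'] at h
      simp only [Prod.mk.injEq, true_and] at h
      have h1 := slot_lt hn hj ha' hA'
      have h2 := Nat.div_lt_of_lt_mul (h1.trans_eq (mul_comm _ _))
      omega
  by_cases hA : i % p + 1 < p ∧ a < Δ <;> by_cases hA' : i % p + 1 < p ∧ a' < Δ
  · rw [bicliqueLabel_own hi hA, bicliqueLabel_own hi hA']
  · exact (key a a' ha' hA hA' h).elim
  · exact (key a' a ha hA' hA h.symm).elim
  · have hΔ : 0 < Δ := by
      rcases Nat.eq_zero_or_pos Δ with rfl | hΔ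
      · exfalso
        have : 0 < p * n := Nat.mul_pos hp (by omega)
        omega
      · exact hΔ
    rcases lt_or_ge (slot p n Δ (i % p) a) Δ with hs | hs <;>
      rcases lt_or_ge (slot p n Δ (i % p) a') Δ with hs' | hs'
    · rw [bicliqueLabel_root hi hA hs, bicliqueLabel_root hi hA' hs']
    · rw [bicliqueLabel_root hi hA hs, bicliqueLabel_slot hi hA' hs'] at h
      simp only [Prod.mk.injEq] at h
      have := Nat.div_pos hs' hΔ
      omega
    · rw [bicliqueLabel_slot hi hA hs, bicliqueLabel_root hi hA' hs'] at h
      simp only [Prod.mk.injEq] at h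
      have := Nat.div_pos hs hΔ
      omega
    · rw [bicliqueLabel_slot hi hA hs, bicliqueLabel_slot hi hA' hs']

/-- A choice of one vertex from each of `p` consecutive parts without an adjacent pair uses the
biclique which joins the two halves. -/
lemma exists_root (hp : 0 < p) (hn : p * n ≤ Δ * (2 * p - 1)) {H : ℕ} (hH : H < 2 * (d + 1))
    (f : ℕ → ℕ) (hf : ∀ j, j < p → f j < n)
    (hind : ∀ j j', j < p → j' < p →
      (bicliqueLabel p d n Δ (p * H + j) (f j)).1 = (bicliqueLabel p d n Δ (p * H + j') (f j')).1 →
      (bicliqueLabel p d n Δ (p * H + j) (f j)).2 =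
        (bicliqueLabel p d n Δ (p * H + j') (f j')).2) :
    ∃ j < p, bicliqueLabel p d n Δ (p * H + j) (f j) = ((H / 2, 0), decide (H % 2 = 1)) := by
  by_contra! hno
  have hi : ∀ j, j < p → p * H + j < 2 * p * (d + 1) := by
    intro j hj
    have : p * (H + 1) ≤ p * (2 * (d + 1)) := Nat.mul_le_mul_left _ hH
    nlinarith
  have hdiv : ∀ j, j < p → (p * H + j) / p = H := by
    intro j hj
    rw [Nat.mul_add_div hp, Nat.div_eq_of_lt hj, add_zero]
  have hmod : ∀ j, j < p → (p * H + j) % p = j := by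
    intro j hj
    rw [Nat.mul_add_mod, Nat.mod_eq_of_lt hj]
  -- Without a root vertex, every part must use its own block of `Δ` vertices: any other choice
  -- faces the own block of an earlier part, already in use. The last part has no such block.
  have key : ∀ j, j < p → j + 1 < p ∧ f j < Δ := by
    intro j
    induction j using Nat.strong_induction_on with
    | _ j ih =>
    intro hj
    by_contra hA
    have hA' : ¬ ((p * H + j) % p + 1 < p ∧ f j < Δ) := by rwa [hmod j hj]
    rcases lt_or_ge (slot p n Δ j (f j)) Δ with hs | hs
    · have := bicliqueLabel_root (d := d) (hi j hj) hA' (by rwa [hmod j hj])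
      rw [hdiv j hj] at this
      exact hno j hj this
    · have h1 := bicliqueLabel_slot (d := d) (hi j hj) hA' (by rwa [hmod j hj])
      rw [hdiv j hj, hmod j hj] at h1
      have h2 := slot_lt hn hj (hf j hj) hA
      have h3 := Nat.div_lt_of_lt_mul (h2.trans_eq (mul_comm _ _))
      have hΔ : 0 < Δ := by
        rcases Nat.eq_zero_or_pos Δ with rfl | hΔ
        · simp at h2
        · exact hΔ
      have h4 := Nat.div_pos hs hΔ
      obtain ⟨j', hj'⟩ : ∃ j', slot p n Δ j (f j) / Δ = j' + 1 :=
        ⟨slot p n Δ j (f j) / Δ - 1, by omega⟩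
      have hj'p : j' < p := by omega
      have h5 := ih j' (by omega) hj'p
      have h6 := bicliqueLabel_own (d := d) (n := n) (hi j' hj'p) (by rwa [hmod j' hj'p])
      rw [hdiv j' hj'p, hmod j' hj'p] at h6
      have := hind j j' hj hj'p (by rw [h1, h6, hj'])
      rw [h1, h6] at this
      simp at this
  have := key (p - 1) (by omega)
  omega

/-- The extremal construction for partial independent transversals. -/
lemma exists_extremal_graph (p d n Δ r : ℕ) (hp : 0 < p) (hd : d < r)
    (hr : 2 * p * (d + 1) ≤ r) (hn : p * n ≤ Δ * (2 * p - 1)) :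
    ∃ (V : Type) (_ : Fintype V) (G : SimpleGraph V) (_ : DecidableRel G.Adj)
      (C : G.Coloring (Fin r)), (∀ i, (C.colorClass i).ncard = n) ∧ (∀ v, G.degree v ≤ Δ) ∧
        ¬ HasPartialIT G C (r - d) := by
  classical
  let f : Fin r × Fin n → (ℕ × ℕ) × Bool := fun v => bicliqueLabel p d n Δ v.1 v.2
  let C : (bicliqueGraph f).Coloring (Fin r) := SimpleGraph.Coloring.mk Prod.fst (by
    rintro ⟨i, a⟩ ⟨i', a'⟩ h hii'
    obtain rfl : i = i' := hii'
    exact h.2 (bicliqueLabel_side hp hn a.2 a'.2 h.1))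
  refine ⟨Fin r × Fin n, inferInstance, bicliqueGraph f, Classical.decRel _, C, ?_, ?_, ?_⟩
  · intro i
    have : C.colorClass i = Set.range fun a : Fin n => (i, a) := by
      ext ⟨i', a⟩
      constructor
      · intro h
        obtain rfl : i' = i := h
        exact ⟨a, rfl⟩
      · rintro ⟨b, hb⟩
        exact (congrArg Prod.fst hb).symm
    rw [this, ← Set.image_univ, Set.ncard_image_of_injective _ (by intro a b h; simpa using h),
      Set.ncard_univ, Nat.card_fin]
  · rintro v
    have hΔ : 0 < Δ := by
      rcases Nat.eq_zero_or_pos Δ with rfl | hΔ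
      · have : 0 < p * n := Nat.mul_pos hp (by have := v.2.2; omega)
        omega
      · exact hΔ
    rw [← SimpleGraph.card_neighborFinset_eq_degree, ← Finset.card_range Δ]
    have hlow : ∀ u, (bicliqueGraph f).Adj v u → (u.1 : ℕ) < 2 * p * (d + 1) := by
      intro u hu
      by_contra! hle
      have h1 : f u = ((d + 1, 0), false) := bicliqueLabel_of_le hle
      have h2 : (f v).1 = (d + 1, 0) := by rw [hu.1, h1]
      have h3 : f v = ((d + 1, 0), false) :=
        bicliqueLabel_of_le (le_of_bicliqueLabel_eq hp hΔ h2)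
      exact hu.2 (by rw [h1, h3])
    refine Finset.card_le_card_of_injOn (fun u => bicliqueIndex p n Δ u.1 u.2) ?_ ?_
    · intro u _
      exact Finset.mem_coe.2 (Finset.mem_range.2 (bicliqueIndex_lt hΔ _ _))
    · intro u hu u' hu' h
      rw [Finset.mem_coe, SimpleGraph.mem_neighborFinset] at hu hu'
      have hff : f u = f u' := by
        refine Prod.ext (hu.1.symm.trans hu'.1) ?_
        have h1 := hu.2
        have h2 := hu'.2
        revert h1 h2
        cases (f v).2 <;> cases (f u).2 <;> cases (f u').2 <;> simp
      obtain ⟨h1, h2⟩ := bicliqueIndex_inj hp hΔ u.2.2 u'.2.2 (hlow u hu) (hlow u' hu') hff h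
      exact Prod.ext (Fin.ext h1) (Fin.ext h2)
  · rintro ⟨S, hS, hinj, hcard⟩
    have hmiss : (Finset.univ \ S.image C).card = d := by
      rw [Finset.card_sdiff_of_subset (Finset.subset_univ _), Finset.card_univ, Fintype.card_fin,
        Finset.card_image_of_injOn hinj, hcard]
      omega
    -- Only `d` parts are missed, so one of the `d + 1` copies is met in all its parts; its two
    -- halves then contribute adjacent root vertices.
    obtain ⟨e, he, heM⟩ : ∃ e ∈ Finset.range (d + 1),
        e ∉ (Finset.univ \ S.image C).image fun i : Fin r => (i : ℕ) / (2 * p) := by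
      refine Finset.exists_mem_notMem_of_card_lt_card ?_
      rw [Finset.card_range]
      exact (Finset.card_image_le.trans hmiss.le).trans_lt (Nat.lt_succ_self d)
    rw [Finset.mem_range] at he
    have hhit : ∀ i : ℕ, i / (2 * p) = e → ∃ a, ∃ (hi : i < r) (ha : a < n),
        ((⟨i, hi⟩, ⟨a, ha⟩) : Fin r × Fin n) ∈ S := by
      intro i hi
      have hir : i < r := by
        have h1 : i < 2 * p * (e + 1) := by
          rw [← hi]
          exact Nat.lt_mul_div_succ i (by omega)
        exact h1.trans_le ((Nat.mul_le_mul_left _ he).trans hr)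
      have : (⟨i, hir⟩ : Fin r) ∈ S.image C := by
        by_contra hh
        refine heM (Finset.mem_image.2 ⟨⟨i, hir⟩, ?_, hi⟩)
        simpa using hh
      obtain ⟨⟨i', a⟩, hv, hvi⟩ := Finset.mem_image.1 this
      obtain rfl : i' = ⟨i, hir⟩ := hvi
      exact ⟨a, hir, a.2, hv⟩
    choose! g hg using hhit
    have hind : ∀ i i', i / (2 * p) = e → i' / (2 * p) = e →
        (bicliqueLabel p d n Δ i (g i)).1 = (bicliqueLabel p d n Δ i' (g i')).1 →
        (bicliqueLabel p d n Δ i (g i)).2 = (bicliqueLabel p d n Δ i' (g i')).2 := by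
      intro i i' hi hi' hl
      obtain ⟨hir, ha, hv⟩ := hg i hi
      obtain ⟨hir', ha', hv'⟩ := hg i' hi'
      by_contra hne
      have hadj : (bicliqueGraph f).Adj (⟨i, hir⟩, ⟨g i, ha⟩) (⟨i', hir'⟩, ⟨g i', ha'⟩) :=
        ⟨hl, hne⟩
      exact hS hv hv' hadj.ne hadj
    have hdiv : ∀ H j, H / 2 = e → j < p → (p * H + j) / (2 * p) = e := by
      intro H j hH hj
      rw [mul_comm 2 p, ← Nat.div_div_eq_div_mul, Nat.mul_add_div hp, Nat.div_eq_of_lt hj,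
        add_zero, hH]
    have hroot : ∀ H, H / 2 = e → ∃ i, i / (2 * p) = e ∧
        bicliqueLabel p d n Δ i (g i) = ((e, 0), decide (H % 2 = 1)) := by
      intro H hH
      obtain ⟨j, hj, hl⟩ := exists_root (d := d) hp hn (H := H) (by omega)
        (fun j => g (p * H + j)) (fun j hj => (hg _ (hdiv H j hH hj)).2.1)
        (fun j j' hj hj' => hind _ _ (hdiv H j hH hj) (hdiv H j' hH hj'))
      exact ⟨p * H + j, hdiv H j hH hj, by rw [hl, hH]⟩
    obtain ⟨i, hi, hl⟩ := hroot (2 * e) (by omega)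
    obtain ⟨i', hi', hl'⟩ := hroot (2 * e + 1) (by omega)
    have := hind i i' hi hi' (by rw [hl, hl'])
    rw [hl, hl'] at this
    simp only [decide_eq_decide] at this
    omega

end Construction

/-! ### Numerical conditions for equal parts, and multipartite complements. -/

section Counting

variable {V : Type*} [Fintype V] {r n Δ d q k : ℕ}

lemma ncard_colorClass {G : SimpleGraph V} (C : G.Coloring (Fin r)) (i : Fin r) :
    (C.colorClass i).ncard = (Finset.univ.filter fun v => C v = i).card := by
  rw [← Set.ncard_coe_finset]
  congr 1
  ext v
  simp [SimpleGraph.Coloring.colorClass]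

lemma card_filter_color {G : SimpleGraph V} (C : G.Coloring (Fin r)) (D : Finset (Fin r)) :
    (Finset.univ.filter fun v => C v ∈ D).card = ∑ i ∈ D, (C.colorClass i).ncard := by
  rw [Finset.card_eq_sum_card_fiberwise (f := C) (t := D) (by intro v hv; simpa using hv)]
  refine Finset.sum_congr rfl fun i hi => ?_
  rw [ncard_colorClass, Finset.filter_filter]
  congr 1
  ext v
  simp only [Finset.mem_filter, Finset.mem_univ, true_and, and_iff_right_iff_imp]
  rintro rfl
  exact hi

/-- Graphs without a partial independent transversal have small parts. -/
lemma part_size_le {G : SimpleGraph V} [DecidableRel G.Adj] (C : G.Coloring (Fin r)) (hd : d < r)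
    (hr : r = q * (d + 1) + k) (hk : k ≤ d) (hqk : 4 * k ≤ q)
    (hn : ∀ i, n ≤ (C.colorClass i).ncard) (hdeg : ∀ v, G.degree v ≤ Δ)
    (hno : ¬ HasPartialIT G C (r - d)) : n * q ≤ 2 * Δ * (q - 1) := by
  classical
  by_contra! hlt
  have hq : 1 ≤ q := by
    rcases Nat.eq_zero_or_pos q with rfl | h
    · simp at hlt
    · exact h
  obtain ⟨q, rfl⟩ : ∃ q', q = q' + 1 := ⟨q - 1, by omega⟩
  rw [Nat.add_sub_cancel] at hlt
  have hU : ∀ D : Finset (Fin r), n * D.card ≤ (Finset.univ.filter fun v => C v ∈ D).card := by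
    intro D
    rw [card_filter_color, mul_comm, ← smul_eq_mul]
    exact Finset.card_nsmul_le_sum _ _ _ fun i _ => hn i
  have hmain : ∀ D : Finset (Fin r), D.Nonempty →
      D.card * (2 * Δ * q + 1) ≤ (q + 1) * (Finset.univ.filter fun v => C v ∈ D).card := by
    intro D _
    have h1 := Nat.mul_le_mul_left (q + 1) (hU D)
    have h2 := Nat.mul_le_mul_left D.card (Nat.succ_le_of_lt hlt)
    have h3 : D.card * (n * (q + 1)) = (q + 1) * (n * D.card) := by ring
    exact (h2.trans_eq h3).trans h1
  obtain ⟨J, T, hT, hJ⟩ := exists_partial_transversal (c := C) (m := d + 1) (q := q + 1) hdeg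
    (by rw [Fintype.card_fin]; exact hd) (by
      rw [Fintype.card_fin, hr]
      nlinarith) (by
      intro D hD
      have h1 := hmain D hD
      have h2 : D.card ≤ r := (Finset.card_le_univ D).trans_eq (Fintype.card_fin r)
      have h3 := hD.card_pos
      set t := D.card
      set u := (Finset.univ.filter fun v => C v ∈ D).card
      have h4 : 4 * Δ * t ≤ 4 * Δ * ((q + 1) * (d + 1) + k) :=
        Nat.mul_le_mul_left _ (h2.trans_eq hr)
      -- The `k` surplus colours cost `4 * Δ * k` after scaling by the number called `q` in the
      -- statement; `hqk` fits this into the slack `Δ` of the size condition.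
      have h5 : Δ * (4 * k) ≤ Δ * (q + 1) := Nat.mul_le_mul_left _ hqk
      have h6 : (q + 1) * (4 * Δ * t) < (q + 1) * (2 * u + 4 * Δ * (d + 1) + Δ) := by
        nlinarith
      exact lt_of_mul_lt_mul_left h6 (Nat.zero_le _)) (by
      intro D hD hDq
      have h1 := hmain D hD
      have h3 := hD.card_pos
      set t := D.card
      set u := (Finset.univ.filter fun v => C v ∈ D).card
      have h4 : 2 * Δ * t ≤ 2 * Δ * (q + 1) := Nat.mul_le_mul_left _ hDq
      have h6 : (q + 1) * (2 * Δ * t) < (q + 1) * (u + 2 * Δ) := by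
        nlinarith
      exact lt_of_mul_lt_mul_left h6 (Nat.zero_le _))
  rw [Fintype.card_fin, ← hT.card] at hJ
  obtain ⟨S, hST, hS⟩ := Finset.exists_subset_card_eq (s := T) (n := r - d) (by omega)
  exact hno ⟨S, fun s hs t ht _ => hT.indep s (hST hs) t (hST ht),
    hT.inj.mono (by exact_mod_cast hST), hS⟩

/-- The complement of a multipartite graph inside the complete multipartite graph. -/
def multipartiteCompl (G : SimpleGraph V) (C : G.Coloring (Fin r)) : SimpleGraph V where
  Adj u v := C u ≠ C v ∧ ¬ G.Adj u v
  symm := ⟨fun _ _ h => ⟨h.1.symm, fun h' => h.2 h'.symm⟩⟩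
  loopless := ⟨fun _ h => h.1 rfl⟩

/-- The parts of a multipartite graph are independent in its multipartite complement. -/
def multipartiteComplColoring (G : SimpleGraph V) (C : G.Coloring (Fin r)) :
    (multipartiteCompl G C).Coloring (Fin r) :=
  SimpleGraph.Coloring.mk C fun h => h.1

lemma degree_multipartiteCompl (G : SimpleGraph V) [DecidableRel G.Adj] (C : G.Coloring (Fin r))
    [DecidableRel (multipartiteCompl G C).Adj] (hn : ∀ i, (C.colorClass i).ncard = n) (v : V) :
    (multipartiteCompl G C).degree v + G.degree v = (r - 1) * n := by
  classical
  have hdisj : Disjoint ((multipartiteCompl G C).neighborFinset v) (G.neighborFinset v) := by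
    rw [Finset.disjoint_left]
    intro u hu hu'
    rw [SimpleGraph.mem_neighborFinset] at hu hu'
    exact hu.2 hu'
  have hunion : (multipartiteCompl G C).neighborFinset v ∪ G.neighborFinset v =
      Finset.univ.filter fun u => C u ∈ Finset.univ.erase (C v) := by
    ext u
    simp only [Finset.mem_union, SimpleGraph.mem_neighborFinset, Finset.mem_filter,
      Finset.mem_univ, true_and, Finset.mem_erase, and_true]
    constructor
    · rintro (h | h)
      exacts [h.1.symm, (C.valid h).symm]
    · intro h
      by_cases ha : G.Adj v u
      exacts [.inr ha, .inl ⟨h.symm, ha⟩]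
  rw [← SimpleGraph.card_neighborFinset_eq_degree, ← SimpleGraph.card_neighborFinset_eq_degree,
    ← Finset.card_union_of_disjoint hdisj, hunion, card_filter_color,
    Finset.sum_congr rfl fun i _ => hn i, Finset.sum_const, smul_eq_mul,
    Finset.card_erase_of_mem (Finset.mem_univ _), Finset.card_univ, Fintype.card_fin]

omit [Fintype V] in
lemma not_hasPartialIT_compl {t : ℕ} {G : SimpleGraph V} (C : G.Coloring (Fin r))
    (h : G.CliqueFree t) :
    ¬ HasPartialIT (multipartiteCompl G C) (multipartiteComplColoring G C) t := by
  rintro ⟨S, hS, hinj, hc⟩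
  refine h S ⟨?_, hc⟩
  intro u hu v hv huv
  by_contra ha
  exact hS hu hv huv ⟨fun hc => huv (hinj hu hv hc), ha⟩

omit [Fintype V] in
lemma cliqueFree_compl {t : ℕ} {G : SimpleGraph V} {C : G.Coloring (Fin r)}
    (h : ¬ HasPartialIT G C t) : (multipartiteCompl G C).CliqueFree t := by
  intro S hS
  refine h ⟨S, fun u hu v hv huv => (hS.isClique hu hv huv).2, fun u hu v hv huv => ?_, hS.card_eq⟩
  by_contra hne
  exact (hS.isClique hu hv hne).1 huv

end Counting

/-! ### Both extremal numbers. -/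

theorem corollary1p2 (r d q k : ℕ) (hd : d < r) (hr : r = q * (d + 1) + k) (hk : k ≤ d)
    (hq : Even q) (hqk : 4 * k ≤ q) :
    (∀ Δ : ℕ, IsGreatest (partSizesWithoutIT r (d + 1) Δ) ⌊2 * (Δ : ℚ) * (1 - 1 / (q : ℚ))⌋₊) ∧
    (∀ n : ℕ, 1 ≤ n → ∃ m : ℕ, IsGreatest (minDegreesCliqueFree n r (r - d)) m ∧
      (m : ℤ) = ((r : ℤ) - 1) * (n : ℤ) - ⌈((q : ℚ) * (n : ℚ)) / (2 * ((q : ℚ) - 1))⌉) := by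
  classical
  obtain ⟨p, hp⟩ := hq
  have hp0 : 0 < p := by
    rcases Nat.eq_zero_or_pos p with rfl | h
    · subst hp
      omega
    · exact h
  have hr2 : 2 * p * (d + 1) ≤ r := by
    rw [hr, hp, two_mul]
    exact Nat.le_add_right _ _
  have hqr : q ≤ r := by
    rw [hr]
    nlinarith
  have hpq : ∀ n Δ : ℕ, n * q ≤ 2 * Δ * (q - 1) → p * n ≤ Δ * (2 * p - 1) := by
    intro n Δ h
    rw [hp, ← two_mul] at h
    nlinarith
  have hqQ : (0 : ℚ) < q := by exact_mod_cast (by omega : 0 < q)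
  have hqcast : ((q - 1 : ℕ) : ℚ) = q - 1 := by
    rw [Nat.cast_sub (by omega), Nat.cast_one]
  have hsub : r + 1 - (d + 1) = r - d := by omega
  constructor
  · intro Δ
    have hfloor : ∀ n : ℕ, n ≤ ⌊2 * (Δ : ℚ) * (1 - 1 / (q : ℚ))⌋₊ ↔ n * q ≤ 2 * Δ * (q - 1) := by
      intro n
      have h1 : (0 : ℚ) ≤ 2 * (Δ : ℚ) * (1 - 1 / (q : ℚ)) := by
        have : 1 / (q : ℚ) ≤ 1 := by
          rw [div_le_one hqQ]
          exact_mod_cast (by omega : 1 ≤ q)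
        have : (0 : ℚ) ≤ 1 - 1 / (q : ℚ) := by linarith
        positivity
      have h2 : 2 * (Δ : ℚ) * (1 - 1 / (q : ℚ)) = 2 * Δ * (q - 1) / q := by
        field_simp
      rw [Nat.le_floor_iff h1, h2, le_div_iff₀ hqQ, ← hqcast]
      exact_mod_cast Iff.rfl
    set N := ⌊2 * (Δ : ℚ) * (1 - 1 / (q : ℚ))⌋₊
    constructor
    · have hN := (hfloor N).1 le_rfl
      obtain ⟨V, _, G, _, C, hC, hdeg, hno⟩ :=
        exists_extremal_graph p d N Δ r hp0 hd hr2 (hpq N Δ hN)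
      refine ⟨V, inferInstance, G, inferInstance, C, fun i => (hC i).ge, ?_, by rwa [hsub]⟩
      refine le_antisymm (G.maxDegree_le_of_forall_degree_le Δ hdeg) ?_
      -- The construction only bounds the maximum degree above. Were it below `Δ`, the slack of `2 *
      -- (q - 1) ≥ q` in the inequality would allow `N + 1` in place of `N`.
      by_contra! hlt
      have h1 := part_size_le C hd hr hk hqk (fun i => (hC i).ge)
        (fun v => G.degree_le_maxDegree v) hno
      have h2 : (N + 1) * q ≤ 2 * Δ * (q - 1) := by
        have h3 : (2 * G.maxDegree + 2) * (q - 1) ≤ 2 * Δ * (q - 1) :=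
          Nat.mul_le_mul_right _ (by omega)
        have h4 : q ≤ 2 * (q - 1) := by omega
        nlinarith
      have := (hfloor (N + 1)).2 h2
      omega
    · rintro n ⟨V, _, G, _, C, hC, hdeg, hno⟩
      rw [hsub] at hno
      exact (hfloor n).2 (part_size_le C hd hr hk hqk hC
        (fun v => hdeg ▸ G.degree_le_maxDegree v) hno)
  · intro n hn
    have hceil : ∀ Δ : ℕ, ⌈((q : ℚ) * (n : ℚ)) / (2 * ((q : ℚ) - 1))⌉₊ ≤ Δ ↔
        n * q ≤ 2 * Δ * (q - 1) := by
      intro Δ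
      have hpos : (0 : ℚ) < 2 * ((q : ℚ) - 1) := by
        rw [← hqcast]
        exact_mod_cast (by omega : 0 < 2 * (q - 1))
      rw [Nat.ceil_le, div_le_iff₀ hpos, ← hqcast]
      rw [show (Δ : ℚ) * (2 * ((q - 1 : ℕ) : ℚ)) = ((2 * Δ * (q - 1) : ℕ) : ℚ) by push_cast; ring,
        show (q : ℚ) * n = ((n * q : ℕ) : ℚ) by push_cast; ring, Nat.cast_le]
    have hint : (⌈((q : ℚ) * (n : ℚ)) / (2 * ((q : ℚ) - 1))⌉ : ℤ) =
        (⌈((q : ℚ) * (n : ℚ)) / (2 * ((q : ℚ) - 1))⌉₊ : ℤ) := by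
      refine (Int.natCast_ceil_eq_ceil ?_).symm
      rw [← hqcast]
      positivity
    rw [hint]
    set Δ := ⌈((q : ℚ) * (n : ℚ)) / (2 * ((q : ℚ) - 1))⌉₊
    -- This keeps the natural subtraction `(r - 1) * n - Δ` from truncating.
    have hΔn : Δ ≤ n := (hceil n).2 (by
      have : q ≤ 2 * (q - 1) := by omega
      nlinarith)
    have hrn : n ≤ (r - 1) * n := Nat.le_mul_of_pos_left _ (by omega)
    refine ⟨(r - 1) * n - Δ, ?_, ?_⟩
    · have hupper : (r - 1) * n - Δ ∈ upperBounds (minDegreesCliqueFree n r (r - d)) := by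
        rintro δ ⟨V, _, G, _, C, hC, hfree, hδ⟩
        -- Minimum degree `δ` turns into maximum degree at most `(r - 1) * n - δ` in the complement,
        -- and cliques into partial transversals.
        have hcomp := degree_multipartiteCompl G C hC
        have h1 := part_size_le (Δ := (r - 1) * n - δ) (multipartiteComplColoring G C) hd hr hk hqk
          (fun i => (hC i).ge) (fun v => by
            have := hcomp v
            have := G.minDegree_le_degree v
            omega) (not_hasPartialIT_compl C hfree)
        have h2 := (hceil _).2 h1
        have h3 : δ ≤ (r - 1) * n := by
          have hpos : 0 < (C.colorClass ⟨0, by omega⟩).ncard := by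
            rw [hC]
            omega
          obtain ⟨v, -⟩ := Set.nonempty_of_ncard_ne_zero hpos.ne'
          have := hcomp v
          have := G.minDegree_le_degree v
          omega
        omega
      refine ⟨?_, hupper⟩
      obtain ⟨V, _, G, _, C, hC, hdeg, hno⟩ :=
        exists_extremal_graph p d n Δ r hp0 hd hr2 (hpq n Δ ((hceil Δ).1 le_rfl))
      have hmem : (multipartiteCompl G C).minDegree ∈ minDegreesCliqueFree n r (r - d) :=
        ⟨V, inferInstance, multipartiteCompl G C, inferInstance, multipartiteComplColoring G C, hC,
          cliqueFree_compl hno, rfl⟩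
      have hpos : 0 < (C.colorClass ⟨0, by omega⟩).ncard := by
        rw [hC]
        omega
      obtain ⟨v, -⟩ := Set.nonempty_of_ncard_ne_zero hpos.ne'
      have : Nonempty V := ⟨v⟩
      have hle : (r - 1) * n - Δ ≤ (multipartiteCompl G C).minDegree := by
        refine SimpleGraph.le_minDegree_of_forall_le_degree _ _ fun v => ?_
        have := degree_multipartiteCompl G C hC v
        have := hdeg v
        omega
      rwa [le_antisymm (hupper hmem) hle] at hmem
    · rw [Nat.cast_sub (hΔn.trans hrn), Nat.cast_mul, Nat.cast_sub (by omega), Nat.cast_one]
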